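/- Let $k$ be a field. A cocommutative Hopf brace over $k$ is a cocommutative $k$-coalgebra $(H,\Delta,\varepsilon)$ with two Hopf algebra structures $(H,\cdot,1,\Delta,\varepsilon,S)$ and $(H,\circ,1_\circ,\Delta,\varepsilon,T)$ on it such that $x\circ(yz)=(x_{(1)}\circ y)\,S(x_{(2)})\,(x_{(3)}\circ z)$ for all $x,y,z\in H$; a morphism is a $k$-linear map that is a morphism of Hopf algebras for both structures. Let $k$-(co)HopfBr be the resulting category. For a family $(C_i)_{i\in I}$ of coalgebras, the tensor product coalgebra $\bigotimes_{i\in I}C_i$ is the inverse limit, in coalgebras, of the finite tensor products $\bigotimes_{i\in F}C_i$ ($F\subseteq I$ finite) along the projections that apply the counits to the omitted factors. Explicitly, it is the largest subspace $D$ of the inverse limit of these vector spaces on which their comultiplications restrict to a map $D\to D\otimes D$. Let $\pi_i:\bigotimes_{j\in I} C_j\to C_i$ denote the projections. Theorem. The category $k$-(co)HopfBr is complete, i.e. it has all small limits. Moreover, let $(H_i)_{i\in I}$ be a small family of cocommutative Hopf braces and let $H=\bigotimes_{i\in I}H_i$ be the tensor product of the underlying coalgebras. 1. If $I$ is finite,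 the canonical map from $H$ to the ordinary tensor product of the $H_i$ is bijective. 2. $(H,(\pi_i)_i)$ is the product of the $H_i$ in the category of cocommutative coalgebras: for every cocommutative coalgebra $E$ and coalgebra maps $f_i:E\to H_i$ there is a unique coalgebra map $g:E\to H$ with $\pi_i g=f_i$ for all $i$. 3. There is a unique Hopf brace structure on the coalgebra $H$, with multiplications $m,\overline m$, units $\eta,u$ and antipodes $S,T$, such that for all $i\in I$ $$\pi_i m=m_i(\pi_i\otimes\pi_i),\quad \pi_i\eta=\eta_i,\quad \pi_iS=S_i\pi_i,\quad \pi_i\overline m=\overline m_i(\pi_i\otimes\pi_i),\quad \pi_iu=u_i,\quad \pi_iT=T_i\pi_i,$$ where $m_i,\eta_i,S_i$ and $\overline m_i,u_i,T_i$ are the structure maps of $H_i$. With this structure, $(H,(\pi_i)_i)$ is the product of the $H_i$ in $k$-(co)HopfBr. -/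

import Mathlib

open TensorProduct CategoryTheory

universe u v w

noncomputable section

/-! ### Finite tensor products of coalgebras -/

namespace PiCoalg

section Merge

variable {k : Type*} [Field k] {ι : Type*}
  {A B C : ι → Type*} [∀ i, AddCommGroup (A i)] [∀ i, Module k (A i)]
  [∀ i, AddCommGroup (B i)] [∀ i, Module k (B i)]
  [∀ i, AddCommGroup (C i)] [∀ i, Module k (C i)]

variable (k A B) in
/-- The canonical map `(⨂ Aᵢ) ⊗ (⨂ Bᵢ) → ⨂ (Aᵢ ⊗ Bᵢ)`. -/
def merge : (⨂[k] i, A i) ⊗[k] (⨂[k] i, B i) →ₗ[k] ⨂[k] i, (A i ⊗[k] B i) :=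
  TensorProduct.lift (PiTensorProduct.map₂ fun i => TensorProduct.mk k (A i) (B i))

@[simp] lemma merge_tprod (a : ∀ i, A i) (b : ∀ i, B i) :
    merge k A B (PiTensorProduct.tprod k a ⊗ₜ PiTensorProduct.tprod k b) =
      PiTensorProduct.tprod k fun i => a i ⊗ₜ[k] b i := by
  simp [merge, PiTensorProduct.map₂_tprod_tprod]

/-- Two linear maps out of `(⨂ Aᵢ) ⊗ (⨂ Bᵢ)` agree if they agree on pure tensors. -/
lemma ext₂ {M : Type*} [AddCommGroup M] [Module k M]
    {f g : (⨂[k] i, A i) ⊗[k] (⨂[k] i, B i) →ₗ[k] M}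
    (h : ∀ a b, f (PiTensorProduct.tprod k a ⊗ₜ PiTensorProduct.tprod k b) =
      g (PiTensorProduct.tprod k a ⊗ₜ PiTensorProduct.tprod k b)) : f = g := by
  refine TensorProduct.ext (PiTensorProduct.ext (MultilinearMap.ext fun a => ?_))
  refine PiTensorProduct.ext (MultilinearMap.ext fun b => ?_)
  exact h a b

lemma merge_bijective [Finite ι] : Function.Bijective (merge k A B) := by
  let a := fun i => Module.Basis.ofVectorSpace k (A i)
  let b := fun i => Module.Basis.ofVectorSpace k (B i)
  let e := ((Basis.piTensorProduct a).tensorProduct (Basis.piTensorProduct b)).equiv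
    (Basis.piTensorProduct fun i => (a i).tensorProduct (b i))
    (Equiv.arrowProdEquivProdArrow _ _ _).symm
  have h : merge k A B = e.toLinearMap := by
    refine ((Basis.piTensorProduct a).tensorProduct (Basis.piTensorProduct b)).ext fun p => ?_
    obtain ⟨p, q⟩ := p
    simp only [LinearEquiv.coe_coe, e, Module.Basis.equiv_apply]
    simp [Module.Basis.tensorProduct_apply, Equiv.arrowProdEquivProdArrow]
  rw [h]
  exact e.bijective

variable (k A B) in
/-- For a finite index set, `(⨂ Aᵢ) ⊗ (⨂ Bᵢ) ≃ ⨂ (Aᵢ ⊗ Bᵢ)`. -/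
def mergeEquiv [Finite ι] :
    (⨂[k] i, A i) ⊗[k] (⨂[k] i, B i) ≃ₗ[k] ⨂[k] i, (A i ⊗[k] B i) :=
  LinearEquiv.ofBijective (merge k A B) merge_bijective

lemma merge_map {A' B' : ι → Type*} [∀ i, AddCommGroup (A' i)] [∀ i, Module k (A' i)]
    [∀ i, AddCommGroup (B' i)] [∀ i, Module k (B' i)]
    (f : ∀ i, A i →ₗ[k] A' i) (g : ∀ i, B i →ₗ[k] B' i) :
    merge k A' B' ∘ₗ TensorProduct.map (PiTensorProduct.map f) (PiTensorProduct.map g) =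
      PiTensorProduct.map (fun i => TensorProduct.map (f i) (g i)) ∘ₗ merge k A B :=
  ext₂ fun a b => by simp

lemma merge_assoc :
    merge k A (fun i => B i ⊗[k] C i) ∘ₗ (merge k B C).lTensor _ ∘ₗ
        (TensorProduct.assoc k _ _ _).toLinearMap =
      PiTensorProduct.map (fun i => (TensorProduct.assoc k (A i) (B i) (C i)).toLinearMap) ∘ₗ
        merge k (fun i => A i ⊗[k] B i) C ∘ₗ (merge k A B).rTensor _ := by
  refine TensorProduct.ext_threefold fun x y z => ?_
  induction x using PiTensorProduct.induction_on with
  | add x x' hx hx' => simp only [TensorProduct.add_tmul, map_add, hx, hx']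
  | smul_tprod r a =>
  induction y using PiTensorProduct.induction_on with
  | add y y' hy hy' => simp only [TensorProduct.add_tmul, TensorProduct.tmul_add, map_add, hy, hy']
  | smul_tprod s b =>
  induction z using PiTensorProduct.induction_on with
  | add z z' hz hz' => simp only [TensorProduct.tmul_add, map_add, hz, hz']
  | smul_tprod t c =>
    simp only [← TensorProduct.smul_tmul', TensorProduct.tmul_smul, map_smul]
    simp

end Merge

section Coalgebra

variable {k : Type*} [Field k] {ι : Type*} [Fintype ι]
  {C : ι → Type*} [∀ i, AddCommGroup (C i)] [∀ i, Module k (C i)] [∀ i, Coalgebra k (C i)]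

/-- `Δ(⊗ cᵢ) = (⊗ cᵢ₍₁₎) ⊗ (⊗ cᵢ₍₂₎)` and `ε(⊗ cᵢ) = ∏ ε(cᵢ)`. -/
instance instCoalgebraStruct : CoalgebraStruct k (⨂[k] i, C i) where
  comul := (mergeEquiv k C C).symm.toLinearMap ∘ₗ
    PiTensorProduct.map fun _ => CoalgebraStruct.comul
  counit := PiTensorProduct.lift
    ((MultilinearMap.mkPiAlgebra k ι k).compLinearMap fun _ => CoalgebraStruct.counit)

lemma merge_comp_comul : merge k C C ∘ₗ CoalgebraStruct.comul =
    PiTensorProduct.map fun i => (CoalgebraStruct.comul : C i →ₗ[k] _) := by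
  ext x
  exact (mergeEquiv k C C).apply_symm_apply _

@[simp] lemma counit_tprod (c : ∀ i, C i) :
    CoalgebraStruct.counit (R := k) (PiTensorProduct.tprod k c) =
      ∏ i, CoalgebraStruct.counit (R := k) (c i) := by
  simp [CoalgebraStruct.counit]

lemma merge_comul (x : ⨂[k] i, C i) : merge k C C (CoalgebraStruct.comul x) =
    PiTensorProduct.map (fun i => (CoalgebraStruct.comul : C i →ₗ[k] _)) x :=
  LinearMap.congr_fun merge_comp_comul x

lemma lid_counit (z : (⨂[k] i, C i) ⊗[k] (⨂[k] i, C i)) :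
    TensorProduct.lid k _ (CoalgebraStruct.counit.rTensor _ z) =
      PiTensorProduct.map (fun i => (TensorProduct.lid k (C i)).toLinearMap ∘ₗ
        CoalgebraStruct.counit.rTensor (C i)) (merge k C C z) := by
  have h : (TensorProduct.lid k _).toLinearMap ∘ₗ
      CoalgebraStruct.counit.rTensor (⨂[k] i, C i) =
      PiTensorProduct.map (fun i => (TensorProduct.lid k (C i)).toLinearMap ∘ₗ
        CoalgebraStruct.counit.rTensor (C i)) ∘ₗ merge k C C :=
    ext₂ fun a b => by simp [MultilinearMap.map_smul_univ]
  exact LinearMap.congr_fun h z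

lemma rid_counit (z : (⨂[k] i, C i) ⊗[k] (⨂[k] i, C i)) :
    TensorProduct.rid k _ (CoalgebraStruct.counit.lTensor _ z) =
      PiTensorProduct.map (fun i => (TensorProduct.rid k (C i)).toLinearMap ∘ₗ
        CoalgebraStruct.counit.lTensor (C i)) (merge k C C z) := by
  have h : (TensorProduct.rid k _).toLinearMap ∘ₗ
      CoalgebraStruct.counit.lTensor (⨂[k] i, C i) =
      PiTensorProduct.map (fun i => (TensorProduct.rid k (C i)).toLinearMap ∘ₗ
        CoalgebraStruct.counit.lTensor (C i)) ∘ₗ merge k C C :=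
    ext₂ fun a b => by simp [MultilinearMap.map_smul_univ]
  exact LinearMap.congr_fun h z

instance instCoalgebra : Coalgebra k (⨂[k] i, C i) where
  coassoc := by
    have inj : Function.Injective
        (merge k C (fun i => C i ⊗[k] C i) ∘ₗ (merge k C C).lTensor (⨂[k] i, C i)) :=
      merge_bijective.injective.comp
        (Module.Flat.lTensor_preserves_injective_linearMap _ merge_bijective.injective)
    refine (LinearMap.cancel_left inj).1 ?_
    have h₁ : (merge k C C).rTensor (⨂[k] i, C i) ∘ₗ CoalgebraStruct.comul.rTensor _ =
        TensorProduct.map (PiTensorProduct.map fun i => (CoalgebraStruct.comul : C i →ₗ[k] _))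
          (PiTensorProduct.map fun _ => LinearMap.id) := by
      rw [← LinearMap.rTensor_comp, merge_comp_comul, PiTensorProduct.map_id]; rfl
    have h₂ : (merge k C C).lTensor (⨂[k] i, C i) ∘ₗ CoalgebraStruct.comul.lTensor _ =
        TensorProduct.map (PiTensorProduct.map fun _ => LinearMap.id)
          (PiTensorProduct.map fun i => (CoalgebraStruct.comul : C i →ₗ[k] _)) := by
      rw [← LinearMap.lTensor_comp, merge_comp_comul, PiTensorProduct.map_id]; rfl
    ext x
    have e₁ := LinearMap.congr_fun (merge_assoc (k := k) (A := C) (B := C) (C := C))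
      (CoalgebraStruct.comul.rTensor _
        (CoalgebraStruct.comul (R := k) (PiTensorProduct.tprod k x)))
    have e₂ := LinearMap.congr_fun h₁ (CoalgebraStruct.comul (R := k) (PiTensorProduct.tprod k x))
    have e₃ := LinearMap.congr_fun h₂ (CoalgebraStruct.comul (R := k) (PiTensorProduct.tprod k x))
    have e₄ := fun z => LinearMap.congr_fun (merge_map (k := k)
      (fun i => (CoalgebraStruct.comul : C i →ₗ[k] _)) (fun i => (LinearMap.id : C i →ₗ[k] C i))) z
    have e₅ := fun z => LinearMap.congr_fun (merge_map (k := k)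
      (fun i => (LinearMap.id : C i →ₗ[k] C i)) (fun i => (CoalgebraStruct.comul : C i →ₗ[k] _))) z
    simp only [LinearMap.comp_apply, LinearMap.compMultilinearMap_apply, LinearEquiv.coe_coe]
      at e₁ e₂ e₃ e₄ e₅ ⊢
    rw [e₁, e₂, e₃, e₄, e₅, merge_comul]
    simp only [PiTensorProduct.map_tprod]
    congr 1
    funext i
    exact Coalgebra.coassoc_apply (x i)
  rTensor_counit_comp_comul := by
    ext x
    refine (TensorProduct.lid k _).injective ?_
    simp only [LinearMap.comp_apply, LinearMap.compMultilinearMap_apply]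
    rw [lid_counit, merge_comul]
    simp
  lTensor_counit_comp_comul := by
    ext x
    refine (TensorProduct.rid k _).injective ?_
    simp only [LinearMap.comp_apply, LinearMap.compMultilinearMap_apply]
    rw [rid_counit, merge_comul]
    simp

lemma comm_comul [∀ i, Coalgebra.IsCocomm k (C i)] (x : ⨂[k] i, C i) :
    TensorProduct.comm k _ _ (Coalgebra.comul (R := k) x) = Coalgebra.comul x := by
  refine merge_bijective.injective ?_
  have h : merge k C C ∘ₗ (TensorProduct.comm k _ _).toLinearMap =
      PiTensorProduct.map (fun i => (TensorProduct.comm k (C i) (C i)).toLinearMap) ∘ₗ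
        merge k C C := ext₂ fun a b => by simp
  have h' := LinearMap.congr_fun h (Coalgebra.comul (R := k) x)
  simp only [LinearMap.comp_apply, LinearEquiv.coe_coe] at h'
  rw [h', merge_comul, ← LinearMap.comp_apply, ← PiTensorProduct.map_comp]
  simp

end Coalgebra

section Restrict

variable {k : Type*} [Field k] {ι : Type*} (C : ι → Type*)
  [∀ i, AddCommGroup (C i)] [∀ i, Module k (C i)] [∀ i, Coalgebra k (C i)]

variable {C} in
open Classical in
variable (k) in
/-- `⊗ cᵢ ↦ (∏_{i ∈ G \ F} ε(cᵢ)) ⊗_{i ∈ F} cᵢ` on families of vectors. -/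
def restrictFun {F G : Finset ι} (h : F ⊆ G) (c : ∀ i : {i // i ∈ G}, C i) :
    ⨂[k] i : {i // i ∈ F}, C i :=
  (∏ i : {i // i ∈ G}, if i.1 ∈ F then 1 else Coalgebra.counit (R := k) (c i)) •
    PiTensorProduct.tprod k fun i : {i // i ∈ F} => c ⟨i, h i.2⟩

lemma restrictFun_update {F G : Finset ι} (h : F ⊆ G) [DecidableEq {i // i ∈ G}]
    (c : ∀ i : {i // i ∈ G}, C i) (j : {i // i ∈ G}) :
    ∃ φ : C j →ₗ[k] ⨂[k] i : {i // i ∈ F}, C i,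
      ∀ x, restrictFun k h (Function.update c j x) = φ x := by
  classical
  have hp : ∀ x : C j, (∏ i : {i // i ∈ G}, if i.1 ∈ F then (1 : k) else
      Coalgebra.counit (R := k) (Function.update c j x i)) =
      (if j.1 ∈ F then (1 : k) else Coalgebra.counit (R := k) x) *
        ∏ i ∈ Finset.univ.erase j, if i.1 ∈ F then (1 : k) else
          Coalgebra.counit (R := k) (c i) := by
    intro x
    rw [← Finset.mul_prod_erase _ _ (Finset.mem_univ j), Function.update_self]
    congr 1
    refine Finset.prod_congr rfl fun i hi => ?_
    rw [Function.update_of_ne (Finset.ne_of_mem_erase hi)]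
  by_cases hj : j.1 ∈ F
  · refine ⟨(∏ i ∈ Finset.univ.erase j, if i.1 ∈ F then (1 : k) else
      Coalgebra.counit (R := k) (c i)) • (PiTensorProduct.tprod k).toLinearMap
        (fun i : {i // i ∈ F} => c ⟨i, h i.2⟩) ⟨j.1, hj⟩, fun x => ?_⟩
    rw [restrictFun, hp, if_pos hj, one_mul, LinearMap.smul_apply]
    congr 1
    change _ = PiTensorProduct.tprod k (Function.update _ _ _)
    congr 1
    funext i
    by_cases hi : i = ⟨j.1, hj⟩
    · subst hi; simp
    · have : (⟨i.1, h i.2⟩ : {i // i ∈ G}) ≠ j := fun e =>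
        hi (Subtype.ext (congrArg (fun t : {i // i ∈ G} => t.1) e))
      rw [Function.update_of_ne hi, Function.update_of_ne this]
  · refine ⟨(∏ i ∈ Finset.univ.erase j, if i.1 ∈ F then (1 : k) else
      Coalgebra.counit (R := k) (c i)) • (Coalgebra.counit (R := k) (A := C j)).smulRight
        (PiTensorProduct.tprod k fun i : {i // i ∈ F} => c ⟨i, h i.2⟩), fun x => ?_⟩
    rw [restrictFun, hp, if_neg hj, LinearMap.smul_apply, LinearMap.smulRight_apply, smul_smul,
      mul_comm]
    congr 2
    funext i
    have : (⟨i.1, h i.2⟩ : {i // i ∈ G}) ≠ j := fun e => hj (congrArg Subtype.val e ▸ i.2)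
    rw [Function.update_of_ne this]

variable (k) in
/-- For finite sets `F ⊆ G` of indices, the projection `⨂_{i ∈ G} Cᵢ → ⨂_{i ∈ F} Cᵢ` that
applies the counit to the factors outside `F`. -/
def restrict {F G : Finset ι} (h : F ⊆ G) :
    (⨂[k] i : {i // i ∈ G}, C i) →ₗ[k] ⨂[k] i : {i // i ∈ F}, C i :=
  PiTensorProduct.lift
    { toFun := restrictFun k h
      map_update_add' := fun c j x y => by
        obtain ⟨φ, hφ⟩ := restrictFun_update (k := k) C h c j
        simp only [hφ, map_add]
      map_update_smul' := fun c j r x => by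
        obtain ⟨φ, hφ⟩ := restrictFun_update (k := k) C h c j
        simp only [hφ, map_smul] }

@[simp] lemma restrict_tprod {F G : Finset ι} (h : F ⊆ G) (c : ∀ i : {i // i ∈ G}, C i) :
    restrict k C h (PiTensorProduct.tprod k c) = restrictFun k h c :=
  PiTensorProduct.lift.tprod _

lemma counit_restrict_empty (F : Finset ι) (x : ⨂[k] i : {i // i ∈ F}, C i) :
    Coalgebra.counit (R := k) (restrict k C (Finset.empty_subset F) x) = Coalgebra.counit x := by
  have h : Coalgebra.counit ∘ₗ restrict k C (Finset.empty_subset F) = Coalgebra.counit := by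
    ext c
    simp [restrictFun]
  exact LinearMap.congr_fun h x

end Restrict

/-! ### Tensor product of an arbitrary family of coalgebras -/

section Separating

variable {k : Type*} [Field k] {J : Type*}

/-- A family of linear maps out of `V`, compatible and jointly injective. -/
structure Separating [Preorder J] {V : Type*} [AddCommGroup V] [Module k V] {P : J → Type*}
    [∀ j, AddCommGroup (P j)] [∀ j, Module k (P j)] (f : ∀ j, V →ₗ[k] P j) : Prop where
  factor : ∀ i j, i ≤ j → ∃ ρ : P j →ₗ[k] P i, f i = ρ ∘ₗ f j
  eq_zero : ∀ v, (∀ j, f j v = 0) → v = 0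

variable {V W : Type*} [AddCommGroup V] [Module k V] [AddCommGroup W] [Module k W]
  {P Q : J → Type*} [∀ j, AddCommGroup (P j)] [∀ j, Module k (P j)]
  [∀ j, AddCommGroup (Q j)] [∀ j, Module k (Q j)]

lemma lTensor_eq_zero {g : ∀ j, W →ₗ[k] Q j} (hg : ∀ w, (∀ j, g j w = 0) → w = 0)
    (z : V ⊗[k] W) (hz : ∀ j, (g j).lTensor V z = 0) : z = 0 := by
  classical
  let b := Module.Basis.ofVectorSpace k V
  refine (TensorProduct.equivFinsuppOfBasisLeft (N := W) b).injective ?_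
  rw [map_zero]
  ext a
  refine hg _ fun j => ?_
  have key : ∀ z : V ⊗[k] W, g j (TensorProduct.equivFinsuppOfBasisLeft b z a) =
      TensorProduct.equivFinsuppOfBasisLeft b ((g j).lTensor V z) a := fun z => by
    induction z using TensorProduct.induction_on with
    | zero => simp
    | tmul v w => simp
    | add x y hx hy => simp only [map_add, Finsupp.add_apply, hx, hy]
  rw [key, hz j]
  simp

lemma rTensor_eq_zero {f : ∀ j, V →ₗ[k] P j} (hf : ∀ v, (∀ j, f j v = 0) → v = 0)
    (z : V ⊗[k] W) (hz : ∀ j, (f j).rTensor W z = 0) : z = 0 := by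
  refine (TensorProduct.comm k V W).injective ?_
  rw [map_zero]
  refine lTensor_eq_zero hf _ fun j => ?_
  rw [← LinearMap.comm_comp_rTensor_comp_comm_eq]
  simp [hz j]

lemma Separating.tensor [Preorder J] [IsDirected J (· ≤ ·)] {f : ∀ j, V →ₗ[k] P j} {g : ∀ j, W →ₗ[k] Q j}
    (hf : Separating f) (hg : Separating g) :
    Separating fun j => TensorProduct.map (f j) (g j) where
  factor i j hij := by
    obtain ⟨ρ, hρ⟩ := hf.factor i j hij
    obtain ⟨σ, hσ⟩ := hg.factor i j hij
    exact ⟨TensorProduct.map ρ σ, by rw [← TensorProduct.map_comp, ← hρ, ← hσ]⟩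
  eq_zero z hz := by
    refine lTensor_eq_zero hg.eq_zero z fun j => rTensor_eq_zero hf.eq_zero _ fun i => ?_
    obtain ⟨l, hi, hj⟩ := directed_of (· ≤ ·) i j
    obtain ⟨ρ, hρ⟩ := hf.factor i l hi
    obtain ⟨σ, hσ⟩ := hg.factor j l hj
    rw [← LinearMap.comp_apply, LinearMap.rTensor_comp_lTensor, hρ, hσ, TensorProduct.map_comp,
      LinearMap.comp_apply, hz l, map_zero]

end Separating

end PiCoalg

open PiCoalg

section InfTensor

variable (k : Type u) [Field k] {ι : Type w} (C : ι → Type v)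
  [∀ i, AddCommGroup (C i)] [∀ i, Module k (C i)] [∀ i, Coalgebra k (C i)]

/-- The tensor product `⨂_{i ∈ F} Cᵢ` over a finite set `F` of indices. -/
abbrev FinTensor (F : Finset ι) : Type (max u v w) := ⨂[k] i : {i // i ∈ F}, C i

/-- The evaluation `x ↦ x_F` on a subspace of `∏_F ⨂_{i ∈ F} Cᵢ`. -/
def evalOn (D : Submodule k (∀ F : Finset ι, FinTensor k C F)) (F : Finset ι) :
    D →ₗ[k] FinTensor k C F :=
  LinearMap.proj F ∘ₗ D.subtype

/-- `D` is a space of compatible families `(x_F)_F`, `x_F ∈ ⨂_{i ∈ F} Cᵢ`, i.e. a subspace of the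
inverse limit of the vector spaces `⨂_{i ∈ F} Cᵢ` along the projections given by the counits, and
the comultiplications of the finite tensor products restrict to a map `D → D ⊗ D`. -/
structure IsSubcoalgebra (D : Submodule k (∀ F : Finset ι, FinTensor k C F)) : Prop where
  compatible : ∀ x ∈ D, ∀ (F G : Finset ι) (h : F ⊆ G), restrict k C h (x G) = x F
  comul_mem : ∀ x ∈ D, ∃ z : D ⊗[k] D, ∀ F : Finset ι,
    TensorProduct.map (evalOn k C D F) (evalOn k C D F) z = Coalgebra.comul (R := k) (x F)

/-- The largest subcoalgebra of the inverse limit of the finite tensor products. -/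
def infTensorSubmodule : Submodule k (∀ F : Finset ι, FinTensor k C F) :=
  sSup {D | IsSubcoalgebra k C D}

lemma isSubcoalgebra_infTensorSubmodule : IsSubcoalgebra k C (infTensorSubmodule k C) where
  compatible _ hx := by
    let L : Submodule k (∀ F : Finset ι, FinTensor k C F) :=
      { carrier := {x | ∀ (F G : Finset ι) (h : F ⊆ G), restrict k C h (x G) = x F}
        add_mem' := fun {x y} hx hy F G h => by simp [hx F G h, hy F G h]
        zero_mem' := fun F G h => by simp
        smul_mem' := fun r x hx F G h => by simp [hx F G h] }
    have h : infTensorSubmodule k C ≤ L := sSup_le fun D hD x hx => hD.compatible x hx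
    exact h hx
  comul_mem _ hx := by
    let T := infTensorSubmodule k C
    let L : Submodule k (∀ F : Finset ι, FinTensor k C F) :=
      { carrier := {x | ∃ z : T ⊗[k] T, ∀ F : Finset ι,
          TensorProduct.map (evalOn k C T F) (evalOn k C T F) z = Coalgebra.comul (R := k) (x F)}
        add_mem' := by
          rintro x y ⟨z, hz⟩ ⟨z', hz'⟩
          exact ⟨z + z', fun F => by simp [hz F, hz' F]⟩
        zero_mem' := ⟨0, fun F => by simp⟩
        smul_mem' := by
          rintro r x ⟨z, hz⟩
          exact ⟨r • z, fun F => by simp [hz F]⟩ }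
    have h : infTensorSubmodule k C ≤ L := sSup_le fun D hD x hx => by
      obtain ⟨z, hz⟩ := hD.comul_mem x hx
      have hDT : D ≤ T := le_sSup hD
      refine ⟨TensorProduct.map (Submodule.inclusion hDT) (Submodule.inclusion hDT) z,
        fun F => ?_⟩
      rw [← hz F, ← LinearMap.comp_apply, ← TensorProduct.map_comp]
      rfl
    exact h hx

/-- The tensor product `⨂_{i ∈ ι} Cᵢ` of an arbitrary family of coalgebras: the inverse limit of
the finite tensor products `⨂_{i ∈ F} Cᵢ` along the counits, formed in coalgebras, i.e. the largest
subcoalgebra of the inverse limit of vector spaces. (The algebraic tensor product of infinitely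
many coalgebras carries no coalgebra structure; for finite `ι` this is the usual one.) -/
def InfTensor : Type (max u v w) := infTensorSubmodule k C

namespace InfTensor

instance : AddCommGroup (InfTensor k C) := inferInstanceAs (AddCommGroup (infTensorSubmodule k C))
instance : Module k (InfTensor k C) := inferInstanceAs (Module k (infTensorSubmodule k C))

/-- The projection `x ↦ x_F` to the tensor product over a finite set `F` of indices. -/
def toFin (F : Finset ι) : InfTensor k C →ₗ[k] FinTensor k C F :=
  evalOn k C (infTensorSubmodule k C) F

lemma separating_toFin : Separating (toFin k C) where
  factor F G h := ⟨restrict k C h, LinearMap.ext fun x =>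
    ((isSubcoalgebra_infTensorSubmodule k C).compatible x.1 x.2 F G h).symm⟩
  eq_zero _ hx := Subtype.ext (funext hx)

lemma exists_comul (x : InfTensor k C) : ∃ z : InfTensor k C ⊗[k] InfTensor k C, ∀ F,
    TensorProduct.map (toFin k C F) (toFin k C F) z = Coalgebra.comul (R := k) (toFin k C F x) :=
  (isSubcoalgebra_infTensorSubmodule k C).comul_mem x.1 x.2

variable {k C} in
lemma eq_of_toFin₂ {z z' : InfTensor k C ⊗[k] InfTensor k C}
    (h : ∀ F, TensorProduct.map (toFin k C F) (toFin k C F) z =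
      TensorProduct.map (toFin k C F) (toFin k C F) z') : z = z' :=
  sub_eq_zero.1 <| ((separating_toFin k C).tensor (separating_toFin k C)).eq_zero _ fun F => by
    rw [map_sub, h F, sub_self]

/-- The comultiplication and counit for which all projections `toFin` are coalgebra maps. -/
instance : CoalgebraStruct k (InfTensor k C) where
  comul :=
    { toFun := fun x => (exists_comul k C x).choose
      map_add' := fun x y => eq_of_toFin₂ fun F => by
        rw [map_add, (exists_comul k C _).choose_spec F, (exists_comul k C _).choose_spec F,
          (exists_comul k C _).choose_spec F, map_add, map_add]
      map_smul' := fun r x => eq_of_toFin₂ fun F => by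
        rw [map_smul, (exists_comul k C _).choose_spec F, (exists_comul k C _).choose_spec F,
          map_smul, map_smul, RingHom.id_apply] }
  counit := Coalgebra.counit ∘ₗ toFin k C ∅

lemma map_toFin_comul (F : Finset ι) (x : InfTensor k C) :
    TensorProduct.map (toFin k C F) (toFin k C F) (CoalgebraStruct.comul (R := k) x) =
      Coalgebra.comul (R := k) (toFin k C F x) :=
  (exists_comul k C x).choose_spec F

lemma counit_toFin (F : Finset ι) :
    Coalgebra.counit (R := k) ∘ₗ toFin k C F = CoalgebraStruct.counit := by
  ext x
  have h := (isSubcoalgebra_infTensorSubmodule k C).compatible x.1 x.2 ∅ F (Finset.empty_subset F)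
  have h' := counit_restrict_empty C F (toFin k C F x)
  exact h'.symm.trans (congrArg Coalgebra.counit h)

lemma map_toFin_comp_comul (F : Finset ι) :
    TensorProduct.map (toFin k C F) (toFin k C F) ∘ₗ CoalgebraStruct.comul =
      Coalgebra.comul (R := k) ∘ₗ toFin k C F :=
  LinearMap.ext (map_toFin_comul k C F)

lemma toFin_lid (F : Finset ι) (z : InfTensor k C ⊗[k] InfTensor k C) :
    toFin k C F (TensorProduct.lid k _ (CoalgebraStruct.counit.rTensor _ z)) =
      TensorProduct.lid k _ (Coalgebra.counit.rTensor _
        (TensorProduct.map (toFin k C F) (toFin k C F) z)) := by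
  rw [← counit_toFin k C F]
  induction z using TensorProduct.induction_on with
  | zero => simp
  | tmul x y => simp
  | add x y hx hy => simp only [map_add, hx, hy]

lemma toFin_rid (F : Finset ι) (z : InfTensor k C ⊗[k] InfTensor k C) :
    toFin k C F (TensorProduct.rid k _ (CoalgebraStruct.counit.lTensor _ z)) =
      TensorProduct.rid k _ (Coalgebra.counit.lTensor _
        (TensorProduct.map (toFin k C F) (toFin k C F) z)) := by
  rw [← counit_toFin k C F]
  induction z using TensorProduct.induction_on with
  | zero => simp
  | tmul x y => simp
  | add x y hx hy => simp only [map_add, hx, hy]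

instance : Coalgebra k (InfTensor k C) where
  coassoc := by
    ext x
    refine sub_eq_zero.1 <| ((separating_toFin k C).tensor
      ((separating_toFin k C).tensor (separating_toFin k C))).eq_zero _ fun F => ?_
    rw [map_sub, sub_eq_zero]
    have h := map_toFin_comp_comul k C F
    have e₁ : TensorProduct.map (TensorProduct.map (toFin k C F) (toFin k C F)) (toFin k C F) ∘ₗ
        CoalgebraStruct.comul.rTensor _ = Coalgebra.comul.rTensor _ ∘ₗ
          TensorProduct.map (toFin k C F) (toFin k C F) := by
      rw [LinearMap.rTensor, LinearMap.rTensor, ← TensorProduct.map_comp, ← TensorProduct.map_comp,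
        h, LinearMap.comp_id, LinearMap.id_comp]
    have e₂ : TensorProduct.map (toFin k C F) (TensorProduct.map (toFin k C F) (toFin k C F)) ∘ₗ
        CoalgebraStruct.comul.lTensor _ = Coalgebra.comul.lTensor _ ∘ₗ
          TensorProduct.map (toFin k C F) (toFin k C F) := by
      rw [LinearMap.lTensor, LinearMap.lTensor, ← TensorProduct.map_comp, ← TensorProduct.map_comp,
        h, LinearMap.comp_id, LinearMap.id_comp]
    have e₃ := LinearMap.congr_fun (TensorProduct.map_map_comp_assoc_eq
      (toFin k C F) (toFin k C F) (toFin k C F))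
      (CoalgebraStruct.comul.rTensor _ (CoalgebraStruct.comul x))
    have e₁' := LinearMap.congr_fun e₁ (CoalgebraStruct.comul x)
    have e₂' := LinearMap.congr_fun e₂ (CoalgebraStruct.comul x)
    simp only [LinearMap.comp_apply, LinearEquiv.coe_coe] at e₁' e₂' e₃ ⊢
    rw [e₃, e₁', e₂', map_toFin_comul, Coalgebra.coassoc_apply]
  rTensor_counit_comp_comul := by
    ext x
    refine (TensorProduct.lid k _).injective (sub_eq_zero.1 <|
      (separating_toFin k C).eq_zero _ fun F => ?_)
    rw [map_sub, LinearMap.comp_apply, toFin_lid, map_toFin_comul, Coalgebra.rTensor_counit_comul]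
    simp
  lTensor_counit_comp_comul := by
    ext x
    refine (TensorProduct.rid k _).injective (sub_eq_zero.1 <|
      (separating_toFin k C).eq_zero _ fun F => ?_)
    rw [map_sub, LinearMap.comp_apply, toFin_rid, map_toFin_comul, Coalgebra.lTensor_counit_comul]
    simp

instance [∀ i, Coalgebra.IsCocomm k (C i)] : Coalgebra.IsCocomm k (InfTensor k C) where
  comm_comp_comul := by
    ext x
    refine eq_of_toFin₂ fun F => ?_
    have h : TensorProduct.map (toFin k C F) (toFin k C F) ∘ₗ
        (TensorProduct.comm k (InfTensor k C) (InfTensor k C)).toLinearMap =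
        (TensorProduct.comm k _ _).toLinearMap ∘ₗ
          TensorProduct.map (toFin k C F) (toFin k C F) := TensorProduct.ext rfl
    have h' := LinearMap.congr_fun h (Coalgebra.comul (R := k) x)
    simp only [LinearMap.comp_apply, LinearEquiv.coe_coe] at h' ⊢
    rw [h', map_toFin_comul, comm_comul]

/-- The identification of the tensor product over `{i}` with `Cᵢ`. -/
def singletonEquiv (i : ι) : FinTensor k C {i} ≃ₗ[k] C i :=
  PiTensorProduct.subsingletonEquiv (R := k) (s := fun j : {j // j ∈ ({i} : Finset ι)} => C j)
    (⟨i, Finset.mem_singleton_self i⟩ : {j // j ∈ ({i} : Finset ι)})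

lemma singletonEquiv_tprod (i : ι) (c : ∀ j : {j // j ∈ ({i} : Finset ι)}, C j) :
    singletonEquiv k C i (PiTensorProduct.tprod k c) = c ⟨i, Finset.mem_singleton_self i⟩ :=
  PiTensorProduct.subsingletonEquiv_apply_tprod _ _

lemma counit_singletonEquiv (i : ι) :
    Coalgebra.counit ∘ₗ (singletonEquiv k C i).toLinearMap = Coalgebra.counit (R := k) := by
  ext c
  simp only [LinearMap.compMultilinearMap_apply, LinearMap.comp_apply, LinearEquiv.coe_coe,
    singletonEquiv_tprod]
  rw [counit_tprod]
  symm
  refine Fintype.prod_eq_single (⟨i, Finset.mem_singleton_self i⟩ : {j // j ∈ ({i} : Finset ι)})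
    fun j hj => absurd (Subtype.ext (Finset.mem_singleton.1 j.2)) hj

lemma comul_singletonEquiv (i : ι) :
    TensorProduct.map (singletonEquiv k C i).toLinearMap (singletonEquiv k C i).toLinearMap ∘ₗ
      Coalgebra.comul = Coalgebra.comul (R := k) ∘ₗ (singletonEquiv k C i).toLinearMap := by
  let e := PiTensorProduct.subsingletonEquiv (R := k)
    (s := fun j : {j // j ∈ ({i} : Finset ι)} => C j ⊗[k] C j)
    (⟨i, Finset.mem_singleton_self i⟩ : {j // j ∈ ({i} : Finset ι)})
  have h : TensorProduct.map (singletonEquiv k C i).toLinearMap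
      (singletonEquiv k C i).toLinearMap = e.toLinearMap ∘ₗ merge k _ _ := ext₂ fun a b => by
    simp [e, singletonEquiv_tprod, PiTensorProduct.subsingletonEquiv_apply_tprod]
  rw [h, LinearMap.comp_assoc, merge_comp_comul]
  ext c
  simp [e, singletonEquiv_tprod, PiTensorProduct.subsingletonEquiv_apply_tprod]

/-- The projection `⨂ Cⱼ → Cᵢ` to a factor, `x ↦ x_{i}`. -/
def proj (i : ι) : InfTensor k C →ₗc[k] C i where
  toLinearMap := (singletonEquiv k C i).toLinearMap ∘ₗ toFin k C {i}
  counit_comp := by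
    rw [← LinearMap.comp_assoc, counit_singletonEquiv, counit_toFin]
  map_comp_comul := by
    rw [TensorProduct.map_comp, LinearMap.comp_assoc, map_toFin_comp_comul, ← LinearMap.comp_assoc,
      comul_singletonEquiv, LinearMap.comp_assoc]

end InfTensor

end InfTensor

/-! ### Hopf braces -/

section HopfBrace

variable (k : Type u) [Field k] (H : Type v) [AddCommGroup H] [Module k H] [Coalgebra k H]

/-- A Hopf algebra structure `(H, m, η, Δ, ε, S)` on a given coalgebra `(H, Δ, ε)`: an associative
unital multiplication whose structure maps `m` and `η` are coalgebra maps, and an antipode. -/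
structure HopfStructure where
  mul : H ⊗[k] H →ₗc[k] H
  unit : k →ₗc[k] H
  antipode : H →ₗ[k] H
  mul_assoc : ∀ x y z : H, mul (mul (x ⊗ₜ y) ⊗ₜ z) = mul (x ⊗ₜ mul (y ⊗ₜ z))
  one_mul : ∀ x : H, mul (unit 1 ⊗ₜ x) = x
  mul_one : ∀ x : H, mul (x ⊗ₜ unit 1) = x
  antipode_mul : ∀ x : H, mul (antipode.rTensor H (Coalgebra.comul x)) =
    unit (Coalgebra.counit (R := k) x)
  mul_antipode : ∀ x : H, mul (antipode.lTensor H (Coalgebra.comul x)) =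
    unit (Coalgebra.counit (R := k) x)

/-- A Hopf brace over the coalgebra `H`: Hopf algebra structures `(H, ·, 1, S)` and `(H, ∘, 1∘, T)`
with `x ∘ (y z) = (x₍₁₎ ∘ y) S(x₍₂₎) (x₍₃₎ ∘ z)`. -/
structure HopfBrace where
  dot : HopfStructure k H
  circ : HopfStructure k H
  compat : ∀ x y z : H, circ.mul (x ⊗ₜ dot.mul (y ⊗ₜ z)) =
    dot.mul (TensorProduct.map
      (dot.mul.toLinearMap ∘ₗ
        TensorProduct.map (circ.mul.toLinearMap ∘ₗ (TensorProduct.mk k H H).flip y) dot.antipode)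
      (circ.mul.toLinearMap ∘ₗ (TensorProduct.mk k H H).flip z)
      (Coalgebra.comul.rTensor H (Coalgebra.comul (R := k) x)))

end HopfBrace

/-- The type of cocommutative Hopf braces over the field `k`. -/
structure CocommHopfBraceCat (k : Type u) [Field k] : Type (max u (v + 1)) where
  carrier : Type v
  [addCommGroup : AddCommGroup carrier]
  [module : Module k carrier]
  [coalgebra : Coalgebra k carrier]
  [isCocomm : Coalgebra.IsCocomm k carrier]
  brace : HopfBrace k carrier

namespace CocommHopfBraceCat

variable {k : Type u} [Field k]

instance : CoeSort (CocommHopfBraceCat.{u, v} k) (Type v) := ⟨carrier⟩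

attribute [instance] addCommGroup module coalgebra isCocomm

/-- Morphisms of Hopf braces: linear maps which are morphisms of Hopf algebras (coalgebra maps
preserving multiplication and unit) for both Hopf algebra structures. -/
@[ext]
structure Hom (X Y : CocommHopfBraceCat.{u, v} k) where
  toCoalgHom : X →ₗc[k] Y
  map_dot : ∀ x y : X, toCoalgHom (X.brace.dot.mul (x ⊗ₜ y)) =
    Y.brace.dot.mul (toCoalgHom x ⊗ₜ toCoalgHom y)
  map_dot_one : toCoalgHom (X.brace.dot.unit 1) = Y.brace.dot.unit 1
  map_circ : ∀ x y : X, toCoalgHom (X.brace.circ.mul (x ⊗ₜ y)) =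
    Y.brace.circ.mul (toCoalgHom x ⊗ₜ toCoalgHom y)
  map_circ_one : toCoalgHom (X.brace.circ.unit 1) = Y.brace.circ.unit 1

instance : Category (CocommHopfBraceCat.{u, v} k) where
  Hom := Hom
  id X := ⟨CoalgHom.id k X, fun _ _ => rfl, rfl, fun _ _ => rfl, rfl⟩
  comp f g :=
    { toCoalgHom := g.toCoalgHom.comp f.toCoalgHom
      map_dot := fun x y => by simp [f.map_dot, g.map_dot]
      map_dot_one := by simp [f.map_dot_one, g.map_dot_one]
      map_circ := fun x y => by simp [f.map_circ, g.map_circ]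
      map_circ_one := by simp [f.map_circ_one, g.map_circ_one] }

/-- The Hopf brace structure `B` on the tensor product coalgebra `⨂ Hᵢ` is the one induced from
the `Hᵢ`: all structure maps of `B` commute with the projections `⨂ Hⱼ → Hᵢ`. -/
structure IsTensorBrace {ι : Type w} (H : ι → CocommHopfBraceCat.{u, v} k)
    (B : HopfBrace k (InfTensor k fun i => H i)) : Prop where
  proj_dot : ∀ i x y, InfTensor.proj k (fun i => H i) i (B.dot.mul (x ⊗ₜ y)) =
    (H i).brace.dot.mul
      (InfTensor.proj k (fun i => H i) i x ⊗ₜ InfTensor.proj k (fun i => H i) i y)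
  proj_dot_one : ∀ i, InfTensor.proj k (fun i => H i) i (B.dot.unit 1) = (H i).brace.dot.unit 1
  proj_dot_antipode : ∀ i x, InfTensor.proj k (fun i => H i) i (B.dot.antipode x) =
    (H i).brace.dot.antipode (InfTensor.proj k (fun i => H i) i x)
  proj_circ : ∀ i x y, InfTensor.proj k (fun i => H i) i (B.circ.mul (x ⊗ₜ y)) =
    (H i).brace.circ.mul
      (InfTensor.proj k (fun i => H i) i x ⊗ₜ InfTensor.proj k (fun i => H i) i y)
  proj_circ_one : ∀ i, InfTensor.proj k (fun i => H i) i (B.circ.unit 1) = (H i).brace.circ.unit 1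
  proj_circ_antipode : ∀ i x, InfTensor.proj k (fun i => H i) i (B.circ.antipode x) =
    (H i).brace.circ.antipode (InfTensor.proj k (fun i => H i) i x)

/-- The cocommutative Hopf brace `(⨂ Hᵢ, B)` together with its projections to the `Hᵢ`. -/
def tensorFan {ι : Type (max u v)} (H : ι → CocommHopfBraceCat.{u, max u v} k)
    (B : HopfBrace k (InfTensor k fun i => H i)) (hB : IsTensorBrace H B) : Limits.Fan H :=
  Limits.Fan.mk
    ({ carrier := InfTensor k fun i => H i, brace := B } : CocommHopfBraceCat.{u, max u v} k)
    fun i => ({ toCoalgHom := InfTensor.proj k (fun i => H i) i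
                map_dot := hB.proj_dot i
                map_dot_one := hB.proj_dot_one i
                map_circ := hB.proj_circ i
                map_circ_one := hB.proj_circ_one i } : Hom _ (H i))

end CocommHopfBraceCat

end

/-! In cocommutative coalgebras the tensor product is the categorical product. An element `x` of `C
⊗ D` is recovered from its coproduct by projecting the first copy to `C` and the second to `D`
(`cons_map_restrict_comul`), so a coalgebra map into `C ⊗ D` is determined by its two components.
Conversely, components `f`, `g` on `E` are paired by `(f ⊗ g) ∘ Δ`, a coalgebra map because `Δ` is
one when `E` is cocommutative. Induction on the index set gives `finHom_ext` and `exists_finHom`.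
For infinitely many factors, a compatible family of coalgebra maps to the finite tensor products has
a subcoalgebra as its joint range, which lies in the largest one (`exists_hom_toFin`); hence
`InfTensor.hom_ext` and `exists_lift`.

All operations of a cocommutative Hopf brace are coalgebra maps, the antipodes included
(`antipodeHom`), and so are both sides of every axiom, read as maps out of tensor powers. Each axiom
may therefore be tested after composition with a family of coalgebra maps that is jointly monic in
coalgebras. This is the content of `HopfStructure.ofJointlyMonic` and `HopfBrace.ofJointlyMonic`.
Joint injectivity is not available: the projections of a tensor product usually have a common
kernel, so elements cannot be compared through them.

The transfer is used twice. For the projections of `⨂ Hᵢ`, the universal property supplies the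
operations and the product of braces results. For the inclusion of the largest subcoalgebra on which
two morphisms agree, the operations restrict and the equalizer results. Products and equalizers give
all limits. -/

noncomputable section

open PiCoalg

namespace PiCoalg

/-! ### Counit projections between finite tensor products are coalgebra maps -/

section RestrictHom

variable {k : Type*} [Field k] {ι : Type*} {C : ι → Type*}
  [∀ i, AddCommGroup (C i)] [∀ i, Module k (C i)] [∀ i, Coalgebra k (C i)]

/-- The indices outside `E` split into those outside `F` and those in `F` but not in `E`; each
contributes its counit exactly once. -/
lemma restrict_restrict {E F G : Finset ι} (h : E ⊆ F) (h' : F ⊆ G)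
    (x : ⨂[k] i : {i // i ∈ G}, C i) :
    restrict k C h (restrict k C h' x) = restrict k C (h.trans h') x := by
  classical
  suffices H : restrict k C h ∘ₗ restrict k C h' = restrict k C (h.trans h') from
    LinearMap.congr_fun H x
  ext c
  simp only [LinearMap.compMultilinearMap_apply, LinearMap.comp_apply, restrict_tprod]
  rw [restrictFun, map_smul, restrict_tprod, restrictFun, restrictFun, smul_smul]
  congr 1
  -- The product over `F` is extended by `1` to `G`, so that the two scalars can be multiplied index
  -- by index.
  rw [Fintype.prod_of_injective (fun i : {i // i ∈ F} => (⟨i, h' i.2⟩ : {i // i ∈ G}))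
    (fun i j hij => Subtype.ext (congrArg (fun t : {i // i ∈ G} => t.1) hij)) _
    (fun i => if i.1 ∈ F then if i.1 ∈ E then (1 : k) else Coalgebra.counit (R := k) (c i) else 1),
    ← Finset.prod_mul_distrib]
  · refine Finset.prod_congr rfl fun i _ => ?_
    by_cases hF : i.1 ∈ F
    · simp [hF]
    · have hE : i.1 ∉ E := fun hE => hF (h hE)
      simp [hF, hE]
  · intro i hi
    have : i.1 ∉ F := fun hF => hi ⟨⟨i, hF⟩, rfl⟩
    simp [this]
  · intro i
    simp

lemma counit_restrict {F G : Finset ι} (h : F ⊆ G) (x : ⨂[k] i : {i // i ∈ G}, C i) :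
    Coalgebra.counit (R := k) (restrict k C h x) = Coalgebra.counit x := by
  rw [← counit_restrict_empty, restrict_restrict, counit_restrict_empty]

/-- The counit of `Cᵢ ⊗ Cᵢ` is the product of the counits, so both sides carry the same scalar. This
moves the question whether `restrict` respects `Δ` to the side of `merge` where `Δ` acts factor by
factor. -/
lemma merge_restrict {F G : Finset ι} (h : F ⊆ G) :
    merge k _ _ ∘ₗ TensorProduct.map (restrict k C h) (restrict k C h) =
      restrict k (fun i => C i ⊗[k] C i) h ∘ₗ merge k _ _ :=
  ext₂ fun a b => by
    simp only [LinearMap.comp_apply, TensorProduct.map_tmul, restrict_tprod, merge_tprod]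
    rw [restrictFun, restrictFun, restrictFun, TensorProduct.smul_tmul_smul, map_smul, merge_tprod,
      ← Finset.prod_mul_distrib]
    congr 1
    refine Finset.prod_congr rfl fun i _ => ?_
    split_ifs
    · simp
    · simp [mul_comm]

variable (C) in
/-- The projection between finite tensor products as a morphism of coalgebras. -/
def restrictHom {F G : Finset ι} (h : F ⊆ G) :
    (⨂[k] i : {i // i ∈ G}, C i) →ₗc[k] ⨂[k] i : {i // i ∈ F}, C i where
  toLinearMap := restrict k C h
  counit_comp := LinearMap.ext (counit_restrict h)
  map_comp_comul := by
    refine (LinearMap.cancel_left (merge_bijective (k := k)).injective).1 ?_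
    rw [← LinearMap.comp_assoc, merge_restrict, LinearMap.comp_assoc, merge_comp_comul,
      ← LinearMap.comp_assoc, merge_comp_comul]
    ext c
    simp only [LinearMap.compMultilinearMap_apply, LinearMap.comp_apply, restrict_tprod,
      PiTensorProduct.map_tprod]
    rw [restrictFun, restrictFun, map_smul, PiTensorProduct.map_tprod]
    congr 1
    refine Finset.prod_congr rfl fun i _ => ?_
    -- An omitted factor contributes `ε(Δ c)` on one side and `ε(c)` on the other; the counit axiom
    -- identifies them.
    have h : Coalgebra.counit (R := k) (Coalgebra.comul (R := k) (c i)) =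
        Coalgebra.counit (R := k) (c i) := by
      have h₁ : (Coalgebra.counit (R := k) (A := C i ⊗[k] C i)) =
          Coalgebra.counit (R := k) (A := C i) ∘ₗ (TensorProduct.lid k (C i)).toLinearMap ∘ₗ
            Coalgebra.counit.rTensor (C i) := by
        ext; simp [mul_comm]
      rw [h₁]
      simp
    rw [h]

@[simp] lemma coe_restrictHom {F G : Finset ι} (h : F ⊆ G) (x : ⨂[k] i : {i // i ∈ G}, C i) :
    restrictHom C h x = restrict k C h x := rfl

end RestrictHom

/-! ### Adjoining one factor to a finite tensor product -/

section Cons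

variable {k : Type*} [Field k] {ι : Type*} [DecidableEq ι] {C : ι → Type*}

/-- Extends a family of vectors indexed by `F` to `F ∪ {a}`. -/
def consFun {F : Finset ι} {a : ι} (c : C a) (x : ∀ i : {i // i ∈ F}, C i) :
    ∀ i : {i // i ∈ insert a F}, C i :=
  fun i => if h : a = i.1 then h ▸ c else
    x ⟨i.1, Finset.mem_of_mem_insert_of_ne i.2 (Ne.symm h)⟩

variable {F : Finset ι} {a : ι}

lemma consFun_self (c : C a) (x : ∀ i : {i // i ∈ F}, C i) (h : a ∈ insert a F) :
    consFun c x ⟨a, h⟩ = c := by simp [consFun]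

lemma consFun_of_ne (c : C a) (x : ∀ i : {i // i ∈ F}, C i) {i : ι} (hi : i ∈ insert a F)
    (h : i ≠ a) :
    consFun c x ⟨i, hi⟩ = x ⟨i, Finset.mem_of_mem_insert_of_ne hi h⟩ := by simp [consFun, h.symm]

lemma consFun_eq_iff {c : C a} {x : ∀ i : {i // i ∈ F}, C i} (ha : a ∉ F)
    {y : ∀ i : {i // i ∈ insert a F}, C i} :
    consFun c x = y ↔ c = y ⟨a, Finset.mem_insert_self a F⟩ ∧
      ∀ i : {i // i ∈ F}, x i = y ⟨i, Finset.mem_insert_of_mem i.2⟩ := by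
  constructor
  · rintro rfl
    refine ⟨(consFun_self c x _).symm, fun i => ?_⟩
    rw [consFun_of_ne]
    rintro h
    exact ha (h ▸ i.2)
  · rintro ⟨h, h'⟩
    funext ⟨i, hi⟩
    by_cases hia : i = a
    · subst hia
      rw [consFun_self, h]
    · rw [consFun_of_ne _ _ _ hia, h']

lemma update_consFun_self (c c' : C a) (x : ∀ i : {i // i ∈ F}, C i) :
    Function.update (consFun c x) ⟨a, Finset.mem_insert_self a F⟩ c' = consFun c' x := by
  funext ⟨i, hi⟩
  by_cases hia : i = a
  · subst hia
    simp [consFun_self]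
  · rw [consFun_of_ne _ _ _ hia, Function.update_of_ne, consFun_of_ne _ _ _ hia]
    exact fun h => hia (congrArg Subtype.val h)

lemma consFun_update [DecidableEq {i // i ∈ F}] (ha : a ∉ F) (c : C a)
    (x : ∀ i : {i // i ∈ F}, C i) (j : {i // i ∈ F}) (y : C j) :
    consFun c (Function.update x j y) =
      Function.update (consFun c x) ⟨j, Finset.mem_insert_of_mem j.2⟩ y := by
  have hj : a ≠ j.1 := fun h => ha (h ▸ j.2)
  refine (consFun_eq_iff ha).2 ⟨?_, fun i => ?_⟩
  · rw [Function.update_of_ne, consFun_self]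
    exact fun h => hj (congrArg Subtype.val h)
  · by_cases hij : i = j
    · subst hij
      simp
    · rw [Function.update_of_ne hij, Function.update_of_ne, consFun_of_ne]
      · exact fun h => ha (h ▸ i.2)
      · exact fun h => hij (Subtype.ext (congrArg (fun t : {i // i ∈ insert a F} => t.1) h))

variable [∀ i, AddCommGroup (C i)] [∀ i, Module k (C i)]

variable (k C) in
/-- The canonical map `C_a ⊗ ⨂_{i ∈ F} Cᵢ → ⨂_{i ∈ F ∪ {a}} Cᵢ` for `a ∉ F`. -/
def cons (ha : a ∉ F) : C a ⊗[k] (⨂[k] i : {i // i ∈ F}, C i) →ₗ[k]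
    ⨂[k] i : {i // i ∈ insert a F}, C i :=
  TensorProduct.lift <| LinearMap.flip <| PiTensorProduct.lift
    { toFun := fun x => (PiTensorProduct.tprod k).toLinearMap
        (consFun (0 : C a) x) ⟨a, Finset.mem_insert_self a F⟩
      map_update_add' := fun x j y z => by
        ext c
        simp only [LinearMap.add_apply, MultilinearMap.toLinearMap_apply, update_consFun_self]
        simp only [consFun_update ha, MultilinearMap.map_update_add]
      map_update_smul' := fun x j r y => by
        ext c
        simp only [LinearMap.smul_apply, MultilinearMap.toLinearMap_apply, update_consFun_self]
        simp only [consFun_update ha, MultilinearMap.map_update_smul] }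

@[simp] lemma cons_tmul_tprod (ha : a ∉ F) (c : C a) (x : ∀ i : {i // i ∈ F}, C i) :
    cons k C ha (c ⊗ₜ PiTensorProduct.tprod k x) = PiTensorProduct.tprod k (consFun c x) := by
  simp [cons, update_consFun_self]

omit [DecidableEq ι] in
lemma cons_ext {M : Type*} [AddCommGroup M] [Module k M]
    {f g : C a ⊗[k] (⨂[k] i : {i // i ∈ F}, C i) →ₗ[k] M}
    (h : ∀ c x, f (c ⊗ₜ PiTensorProduct.tprod k x) = g (c ⊗ₜ PiTensorProduct.tprod k x)) :
    f = g :=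
  TensorProduct.ext <| LinearMap.ext fun c => PiTensorProduct.ext <| MultilinearMap.ext fun x =>
    h c x

/-- The coproduct of a tensor product of two coalgebras ends with the exchange of the middle
factors. After `merge` this exchange becomes invisible, which is what makes `cons` compatible with
`Δ`. -/
lemma merge_cons (ha : a ∉ F) (u : C a ⊗[k] C a)
    (w : (⨂[k] i : {i // i ∈ F}, C i) ⊗[k] (⨂[k] i : {i // i ∈ F}, C i)) :
    merge k _ _ (TensorProduct.map (cons k C ha) (cons k C ha)
      (TensorProduct.AlgebraTensorModule.tensorTensorTensorComm k k k k _ _ _ _ (u ⊗ₜ w))) =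
      cons k (fun i => C i ⊗[k] C i) ha (u ⊗ₜ merge k _ _ w) := by
  induction u using TensorProduct.induction_on with
  | zero => simp
  | add u v hu hv => simp only [TensorProduct.add_tmul, map_add, hu, hv]
  | tmul c c' =>
  induction w using TensorProduct.induction_on with
  | zero => simp
  | add u v hu hv => simp only [TensorProduct.tmul_add, map_add, hu, hv]
  | tmul x y =>
  induction x using PiTensorProduct.induction_on with
  | add x x' hx hx' => simp only [TensorProduct.add_tmul, TensorProduct.tmul_add, map_add, hx, hx']
  | smul_tprod r x =>
  induction y using PiTensorProduct.induction_on with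
  | add y y' hy hy' => simp only [TensorProduct.tmul_add, map_add, hy, hy']
  | smul_tprod s y =>
    simp only [← TensorProduct.smul_tmul', TensorProduct.tmul_smul, map_smul]
    congr 2
    simp only [TensorProduct.AlgebraTensorModule.tensorTensorTensorComm_tmul,
      TensorProduct.map_tmul, cons_tmul_tprod, merge_tprod]
    congr 1
    symm
    refine (consFun_eq_iff ha).2 ⟨?_, fun i => ?_⟩
    · simp [consFun_self]
    · have hi : i.1 ≠ a := fun h => ha (h ▸ i.2)
      rw [consFun_of_ne _ _ _ hi, consFun_of_ne _ _ _ hi]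

variable [∀ i, Coalgebra k (C i)]

lemma counit_consFun (ha : a ∉ F) (c : C a) (x : ∀ i : {i // i ∈ F}, C i)
    (i : {i // i ∈ insert a F}) : Coalgebra.counit (R := k) (consFun c x i) =
      consFun (C := fun _ => k) (Coalgebra.counit (R := k) c)
        (fun i => Coalgebra.counit (R := k) (x i)) i := by
  refine congrFun (f := fun i => Coalgebra.counit (R := k) (consFun c x i)) (Eq.symm ?_) i
  refine (consFun_eq_iff ha).2 ⟨?_, fun i => ?_⟩
  · rw [consFun_self]
  · rw [consFun_of_ne]
    exact fun h => ha (h ▸ i.2)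

lemma prod_consFun {M : Type*} [CommMonoid M] (ha : a ∉ F) (c : M) (x : {i // i ∈ F} → M) :
    ∏ i, consFun (C := fun _ => M) (a := a) c x i = c * ∏ i, x i := by
  rw [← Finset.mul_prod_erase _ _ (Finset.mem_univ ⟨a, Finset.mem_insert_self a F⟩), consFun_self]
  congr 1
  symm
  refine Finset.prod_bij (fun i _ => ⟨i.1, Finset.mem_insert_of_mem i.2⟩) (fun i _ => ?_)
    (fun i _ j _ h => Subtype.ext (congrArg (fun t : {i // i ∈ insert a F} => t.1) h)) (fun i hi => ?_) (fun i _ => ?_)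
  · simp only [Finset.mem_erase, Finset.mem_univ, and_true]
    exact fun h => ha (by
      have h' : i.1 = a := congrArg (fun t : {i // i ∈ insert a F} => t.1) h
      exact h' ▸ i.2)
  · have hia : i.1 ≠ a := fun h => Finset.ne_of_mem_erase hi (Subtype.ext h)
    exact ⟨⟨i.1, Finset.mem_of_mem_insert_of_ne i.2 hia⟩, Finset.mem_univ _, rfl⟩
  · rw [consFun_of_ne]
    exact fun h => ha (h ▸ i.2)

variable (k C) in
/-- The canonical map `cons` as a morphism of coalgebras. -/
def consHom (ha : a ∉ F) : C a ⊗[k] (⨂[k] i : {i // i ∈ F}, C i) →ₗc[k]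
    ⨂[k] i : {i // i ∈ insert a F}, C i where
  toLinearMap := cons k C ha
  counit_comp := cons_ext fun c x => by
    simp only [LinearMap.comp_apply, cons_tmul_tprod, counit_tprod, counit_consFun ha,
      prod_consFun ha, TensorProduct.counit_tmul, smul_eq_mul, mul_comm]
  map_comp_comul := cons_ext fun c x => merge_bijective.injective <| by
    simp only [LinearMap.comp_apply, TensorProduct.comul_tmul, cons_tmul_tprod]
    rw [merge_comul, merge_cons, merge_comul]
    simp only [PiTensorProduct.map_tprod, cons_tmul_tprod]
    congr 1
    refine (consFun_eq_iff ha).2 ⟨?_, fun i => ?_⟩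
    · rw [consFun_self]
    · rw [consFun_of_ne]
      exact fun h => ha (h ▸ i.2)

/-- Only the index `a` is omitted. With `singletonEquiv_restrict_cons`, its counterpart for the
other projection, this yields the components of the pairing in `exists_finHom`. -/
lemma restrict_cons (ha : a ∉ F) (c : C a) (x : ⨂[k] i : {i // i ∈ F}, C i) :
    restrict k C (Finset.subset_insert a F) (cons k C ha (c ⊗ₜ x)) =
      Coalgebra.counit (R := k) c • x := by
  induction x using PiTensorProduct.induction_on with
  | add x x' hx hx' => simp only [TensorProduct.tmul_add, map_add, hx, hx', smul_add]
  | smul_tprod r x =>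
    simp only [TensorProduct.tmul_smul, map_smul, cons_tmul_tprod, restrict_tprod]
    rw [smul_comm]
    congr 1
    rw [restrictFun]
    congr 1
    · rw [Fintype.prod_eq_single (⟨a, Finset.mem_insert_self a F⟩ : {i // i ∈ insert a F}),
        if_neg ha, consFun_self]
      intro i hi
      rw [if_pos]
      exact Finset.mem_of_mem_insert_of_ne i.2 fun h => hi (Subtype.ext h)
    · congr 1
      funext i
      rw [consFun_of_ne]
      exact fun h => ha (h ▸ i.2)

open InfTensor

lemma singletonEquiv_restrict_cons (ha : a ∉ F) (c : C a) (x : ⨂[k] i : {i // i ∈ F}, C i) :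
    singletonEquiv k C a (restrict k C (Finset.singleton_subset_iff.2 (Finset.mem_insert_self a F))
      (cons k C ha (c ⊗ₜ x))) = Coalgebra.counit (R := k) x • c := by
  induction x using PiTensorProduct.induction_on with
  | add x x' hx hx' => simp only [TensorProduct.tmul_add, map_add, hx, hx', add_smul]
  | smul_tprod r x =>
    simp only [TensorProduct.tmul_smul, map_smul, cons_tmul_tprod, restrict_tprod]
    rw [smul_assoc]
    congr 1
    rw [restrictFun, map_smul, singletonEquiv_tprod, consFun_self, counit_tprod]
    congr 1
    -- The index `a` is kept by the restriction to `{a}`, hence the factor `1` there.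
    trans ∏ i, consFun (C := fun _ => k) (a := a) 1 (fun i => Coalgebra.counit (R := k) (x i)) i
    · refine Finset.prod_congr rfl fun ⟨i, hi⟩ _ => ?_
      by_cases h : i = a
      · subst h
        simp [consFun_self]
      · rw [if_neg (by simpa using h), consFun_of_ne _ _ _ h, consFun_of_ne _ _ _ h]
    · rw [prod_consFun ha, one_mul]

/-- An element of `⨂_{i ∈ F ∪ {a}} Cᵢ` is recovered from its coproduct by projecting to `C_a` and
to `⨂_{i ∈ F} Cᵢ`. -/
lemma cons_map_restrict_comul (ha : a ∉ F) (x : ⨂[k] i : {i // i ∈ insert a F}, C i) :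
    cons k C ha (TensorProduct.map ((singletonEquiv k C a).toLinearMap ∘ₗ restrict k C
      (Finset.singleton_subset_iff.2 (Finset.mem_insert_self a F)))
      (restrict k C (Finset.subset_insert a F)) (Coalgebra.comul (R := k) x)) = x := by
  -- After `merge` the composite acts factor by factor: the counit is applied to the second copy at
  -- `a` and to the first copy at every other index.
  have h : cons k C ha ∘ₗ TensorProduct.map ((singletonEquiv k C a).toLinearMap ∘ₗ restrict k C
      (Finset.singleton_subset_iff.2 (Finset.mem_insert_self a F)))
      (restrict k C (Finset.subset_insert a F)) =
      PiTensorProduct.map (fun i : {i // i ∈ insert a F} => if i.1 = a then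
        (TensorProduct.rid k (C i)).toLinearMap ∘ₗ Coalgebra.counit.lTensor (C i) else
        (TensorProduct.lid k (C i)).toLinearMap ∘ₗ Coalgebra.counit.rTensor (C i)) ∘ₗ
      merge k _ _ := ext₂ fun y z => by
    simp only [LinearMap.comp_apply, TensorProduct.map_tmul, restrict_tprod, merge_tprod,
      PiTensorProduct.map_tprod, LinearEquiv.coe_coe]
    have hv : (fun i : {i // i ∈ insert a F} => (if i.1 = a then
        (TensorProduct.rid k (C i)).toLinearMap ∘ₗ Coalgebra.counit.lTensor (C i) else
        (TensorProduct.lid k (C i)).toLinearMap ∘ₗ Coalgebra.counit.rTensor (C i))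
          (y i ⊗ₜ[k] z i)) = fun i => (if i.1 = a then Coalgebra.counit (R := k) (z i) else
            Coalgebra.counit (R := k) (y i)) • (if i.1 = a then y i else z i) := by
      funext i
      split_ifs <;> simp
    rw [hv, MultilinearMap.map_smul_univ, restrictFun, restrictFun, map_smul, singletonEquiv_tprod,
      TensorProduct.smul_tmul_smul, map_smul, cons_tmul_tprod, ← Finset.prod_mul_distrib]
    congr 1
    · refine Finset.prod_congr rfl fun i _ => ?_
      by_cases hi : i.1 = a
      · simp [hi, ha]
      · simp [hi, Finset.mem_of_mem_insert_of_ne i.2 hi]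
    · congr 1
      refine (consFun_eq_iff ha).2 ⟨?_, fun i => ?_⟩
      · rw [if_pos rfl]
      · rw [if_neg]
        exact fun h => ha (h ▸ i.2)
  -- Precomposed with `Δ`, each of these factorwise maps is the identity, by one of the two counit
  -- axioms.
  rw [← LinearMap.comp_apply, h, LinearMap.comp_apply, merge_comul, ← LinearMap.comp_apply,
    ← PiTensorProduct.map_comp]
  refine Eq.trans (congrArg (fun f => PiTensorProduct.map f x) (funext fun i => ?_))
    (LinearMap.congr_fun PiTensorProduct.map_id x)
  ext c
  split_ifs <;> simp

end Cons

/-! ### Finite tensor products as products of cocommutative coalgebras -/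

section FinProduct

open InfTensor

variable {k : Type*} [Field k] {ι : Type*} {C : ι → Type*}
  [∀ i, AddCommGroup (C i)] [∀ i, Module k (C i)] [∀ i, Coalgebra k (C i)]
  {E : Type*} [AddCommGroup E] [Module k E] [Coalgebra k E]

variable (k C) in
/-- The identification of the tensor product over `{i}` with `Cᵢ` as a morphism of coalgebras. -/
def singletonHom (i : ι) : (⨂[k] j : {j // j ∈ ({i} : Finset ι)}, C j) →ₗc[k] C i where
  toLinearMap := (singletonEquiv k C i).toLinearMap
  counit_comp := counit_singletonEquiv k C i
  map_comp_comul := comul_singletonEquiv k C i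

variable (k C) in
/-- The projection from a finite tensor product to a factor. -/
def finProj {F : Finset ι} {i : ι} (hi : i ∈ F) : (⨂[k] j : {j // j ∈ F}, C j) →ₗc[k] C i :=
  (singletonHom k C i).comp (restrictHom C (Finset.singleton_subset_iff.2 hi))

lemma finProj_apply {F : Finset ι} {i : ι} (hi : i ∈ F) (x : ⨂[k] j : {j // j ∈ F}, C j) :
    finProj k C hi x = singletonEquiv k C i (restrict k C (Finset.singleton_subset_iff.2 hi) x) :=
  rfl

lemma finProj_restrict {F G : Finset ι} (h : F ⊆ G) {i : ι} (hi : i ∈ F)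
    (x : ⨂[k] j : {j // j ∈ G}, C j) :
    finProj k C hi (restrict k C h x) = finProj k C (h hi) x := by
  rw [finProj_apply, finProj_apply, restrict_restrict]

lemma restrict_self (F : Finset ι) (x : ⨂[k] j : {j // j ∈ F}, C j) :
    restrict k C (subset_refl F) x = x := by
  suffices H : restrict k C (subset_refl F) = LinearMap.id from LinearMap.congr_fun H x
  ext c
  simp [restrictFun]

/-- The empty tensor product is `k` and its counit is the identification. Coalgebra maps preserve
counits, so any two of them into it agree: this starts the induction in `finHom_ext`. -/
lemma counit_injective_empty :
    Function.Injective (Coalgebra.counit (R := k) (A := ⨂[k] j : {j // j ∈ (∅ : Finset ι)}, C j)) := by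
  have h : Coalgebra.counit (R := k) (A := ⨂[k] j : {j // j ∈ (∅ : Finset ι)}, C j) =
      (PiTensorProduct.isEmptyEquiv {j // j ∈ (∅ : Finset ι)}).toLinearMap := by
    ext c
    simp
  rw [h]
  exact LinearEquiv.injective _

/-- A coalgebra morphism to a finite tensor product is determined by its components. -/
lemma finHom_ext {F : Finset ι} {g g' : E →ₗc[k] ⨂[k] j : {j // j ∈ F}, C j}
    (h : ∀ i (hi : i ∈ F), (finProj k C hi).comp g = (finProj k C hi).comp g') : g = g' := by
  classical
  induction F using Finset.induction_on with
  | empty =>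
    ext x
    refine counit_injective_empty ?_
    rw [CoalgHomClass.counit_comp_apply, CoalgHomClass.counit_comp_apply]
  | insert a F ha ih =>
    have hr := ih (g := (restrictHom C (Finset.subset_insert a F)).comp g)
      (g' := (restrictHom C (Finset.subset_insert a F)).comp g') fun i hi => by
        ext x
        have := CoalgHom.congr_fun (h i (Finset.mem_insert_of_mem hi)) x
        simpa [finProj_restrict] using this
    have hs := h a (Finset.mem_insert_self a F)
    ext x
    rw [← cons_map_restrict_comul ha (g x), ← cons_map_restrict_comul ha (g' x)]
    -- Since `f` commutes with `Δ`, the projected coproduct of `f x` depends only on the two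
    -- components of `f`, which are settled by the hypothesis at `a` and by induction.
    have key : ∀ f : E →ₗc[k] ⨂[k] j : {j // j ∈ insert a F}, C j,
        TensorProduct.map ((singletonEquiv k C a).toLinearMap ∘ₗ restrict k C
          (Finset.singleton_subset_iff.2 (Finset.mem_insert_self a F)))
          (restrict k C (Finset.subset_insert a F)) (Coalgebra.comul (R := k) (f x)) =
        TensorProduct.map ((finProj k C (Finset.mem_insert_self a F)).comp f).toLinearMap
          ((restrictHom C (Finset.subset_insert a F)).comp f).toLinearMap
            (Coalgebra.comul (R := k) x) := fun f => by
      rw [← CoalgHomClass.map_comp_comul_apply, ← LinearMap.comp_apply, ← TensorProduct.map_comp]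
      rfl
    rw [key, key, hr, hs]

/-- The inductive step pairs `f a` with the map `g` already built, as `(f a ⊗ g) ∘ Δ`.
Cocommutativity of `E` enters because `Δ` has to be a coalgebra map; the factors `C i` may be
arbitrary. -/
lemma exists_finHom [Coalgebra.IsCocomm k E] (f : ∀ i, E →ₗc[k] C i) (F : Finset ι) :
    ∃ g : E →ₗc[k] ⨂[k] j : {j // j ∈ F}, C j,
      ∀ i (hi : i ∈ F), (finProj k C hi).comp g = f i := by
  classical
  induction F using Finset.induction_on with
  | empty =>
    let e := (PiTensorProduct.isEmptyEquiv (R := k) (s := fun j => C j)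
      {j // j ∈ (∅ : Finset ι)}).symm.toLinearMap
    have h : ∀ r, e r = r • PiTensorProduct.tprod k isEmptyElim := fun r => rfl
    refine ⟨CoalgHom.comp (B := k) ⟨e, ?_, ?_⟩ (Coalgebra.counitCoalgHom k E), by simp⟩
    · ext
      simp [h]
    · ext
      refine merge_bijective.injective ?_
      simp only [LinearMap.comp_apply, h, one_smul]
      rw [merge_comul]
      simp [h]
      congr 1
      funext i
      exact isEmptyElim i
  | insert a F ha ih =>
    obtain ⟨g, hg⟩ := ih
    refine ⟨(consHom k C ha).comp ((Coalgebra.TensorProduct.map (f a) g).comp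
      (Coalgebra.comulCoalgHom k E)), fun i hi => ?_⟩
    -- Projecting the pairing to one side applies the counit to the other tensor factor of `E ⊗ E`;
    -- evaluated on `Δ x` this returns the component at `x`.
    have key₁ : (finProj k C (Finset.mem_insert_self a F)).toLinearMap ∘ₗ cons k C ha ∘ₗ
        TensorProduct.map (f a).toLinearMap g.toLinearMap = (f a).toLinearMap ∘ₗ
          (TensorProduct.rid k E).toLinearMap ∘ₗ Coalgebra.counit.lTensor E :=
      TensorProduct.ext' fun y z => by
        simp [finProj_apply, singletonEquiv_restrict_cons ha]
    have key₂ : restrict k C (Finset.subset_insert a F) ∘ₗ cons k C ha ∘ₗ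
        TensorProduct.map (f a).toLinearMap g.toLinearMap = g.toLinearMap ∘ₗ
          (TensorProduct.lid k E).toLinearMap ∘ₗ Coalgebra.counit.rTensor E :=
      TensorProduct.ext' fun y z => by
        simp [restrict_cons ha]
    ext x
    obtain rfl | hiF := Finset.mem_insert.1 hi
    · have := LinearMap.congr_fun key₁ (Coalgebra.comul (R := k) x)
      simp only [LinearMap.comp_apply, Coalgebra.lTensor_counit_comul] at this
      refine this.trans ?_
      simp
    · have := LinearMap.congr_fun key₂ (Coalgebra.comul (R := k) x)
      simp only [LinearMap.comp_apply, Coalgebra.rTensor_counit_comul] at this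
      refine (finProj_restrict (Finset.subset_insert a F) hiF _).symm.trans ?_
      refine (congrArg (finProj k C hiF) this).trans ?_
      simp [← hg i hiF]

end FinProduct

end PiCoalg

/-! ### Universal property of the tensor product of an arbitrary family -/

namespace InfTensor

variable {k : Type u} [Field k] {ι : Type w} {C : ι → Type v}
  [∀ i, AddCommGroup (C i)] [∀ i, Module k (C i)] [∀ i, Coalgebra k (C i)]
  {E : Type*} [AddCommGroup E] [Module k E] [Coalgebra k E]

variable (k C) in
/-- The projection to a finite tensor product as a morphism of coalgebras. -/
def toFinHom (F : Finset ι) : InfTensor k C →ₗc[k] FinTensor k C F where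
  toLinearMap := toFin k C F
  counit_comp := counit_toFin k C F
  map_comp_comul := map_toFin_comp_comul k C F

lemma restrict_toFin {F G : Finset ι} (h : F ⊆ G) (x : InfTensor k C) :
    restrict k C h (toFin k C G x) = toFin k C F x :=
  (isSubcoalgebra_infTensorSubmodule k C).compatible x.1 x.2 F G h

lemma finProj_toFin {F : Finset ι} {i : ι} (hi : i ∈ F) (x : InfTensor k C) :
    finProj k C hi (toFin k C F x) = proj k C i x := by
  rw [finProj_apply, restrict_toFin]
  rfl

lemma ext_toFin {x y : InfTensor k C} (h : ∀ F, toFin k C F x = toFin k C F y) : x = y :=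
  Subtype.ext (funext h)

/-- A coalgebra morphism to a tensor product is determined by its components. -/
lemma hom_ext {g g' : E →ₗc[k] InfTensor k C}
    (h : ∀ i, (proj k C i).comp g = (proj k C i).comp g') : g = g' := by
  have H : ∀ F, (toFinHom k C F).comp g = (toFinHom k C F).comp g' := fun F =>
    finHom_ext fun i hi => by
      ext x
      have := CoalgHom.congr_fun (h i) x
      refine (finProj_toFin hi (g x)).trans (Eq.trans ?_ (finProj_toFin hi (g' x)).symm)
      exact this
  ext x
  exact ext_toFin fun F => CoalgHom.congr_fun (H F) x

/-- A compatible family of coalgebra morphisms to the finite tensor products factors through the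
infinite tensor product. -/
lemma exists_hom_toFin (g : ∀ F, E →ₗc[k] FinTensor k C F)
    (hg : ∀ (F G : Finset ι) (h : F ⊆ G) (x : E), restrict k C h (g G x) = g F x) :
    ∃ φ : E →ₗc[k] InfTensor k C, ∀ F x, toFin k C F (φ x) = g F x := by
  let γ : E →ₗ[k] ∀ F, FinTensor k C F := LinearMap.pi fun F => (g F).toLinearMap
  -- The coproduct of `γ x` is witnessed by the image of `Δ x`, so the range is among the
  -- subcoalgebras whose supremum is `infTensorSubmodule`.
  have hγ : IsSubcoalgebra k C (LinearMap.range γ) :=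
    { compatible := by
        rintro _ ⟨x, rfl⟩ F G h
        exact hg F G h x
      comul_mem := by
        rintro _ ⟨x, rfl⟩
        refine ⟨TensorProduct.map γ.rangeRestrict γ.rangeRestrict (Coalgebra.comul (R := k) x),
          fun F => ?_⟩
        rw [← LinearMap.comp_apply, ← TensorProduct.map_comp]
        exact CoalgHomClass.map_comp_comul_apply (g F) x }
  have hle : ∀ x, γ x ∈ infTensorSubmodule k C := fun x =>
    le_sSup (show LinearMap.range γ ∈ {D | IsSubcoalgebra k C D} from hγ) ⟨x, rfl⟩
  let φ : E →ₗ[k] InfTensor k C := γ.codRestrict (infTensorSubmodule k C) hle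
  have hφ : ∀ F, toFin k C F ∘ₗ φ = (g F).toLinearMap := fun F => rfl
  refine ⟨⟨φ, ?_, ?_⟩, fun F x => rfl⟩
  · rw [← counit_toFin k C ∅, LinearMap.comp_assoc, hφ]
    exact (g ∅).counit_comp
  · ext x
    refine eq_of_toFin₂ fun F => ?_
    rw [LinearMap.comp_apply, LinearMap.comp_apply, map_toFin_comul, ← LinearMap.comp_apply,
      ← TensorProduct.map_comp, hφ]
    exact CoalgHomClass.map_comp_comul_apply (g F) x

/-- The lifts to the finite stages are compatible by uniqueness: restricting the lift over `G` to
`F` gives a coalgebra map with the components of the lift over `F`. -/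
lemma exists_lift [Coalgebra.IsCocomm k E] (f : ∀ i, E →ₗc[k] C i) :
    ∃ φ : E →ₗc[k] InfTensor k C, ∀ i, (proj k C i).comp φ = f i := by
  choose g hg using exists_finHom f
  obtain ⟨φ, hφ⟩ := exists_hom_toFin g fun F G h x => by
    have : (restrictHom C h).comp (g G) = g F := finHom_ext fun i hi => by
      rw [hg]
      ext x
      refine (finProj_restrict h hi (g G x)).trans ?_
      rw [← hg G i (h hi)]
      rfl
    exact CoalgHom.congr_fun this x
  refine ⟨φ, fun i => ?_⟩
  ext x
  rw [← hg {i} i (Finset.mem_singleton_self i)]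
  refine (finProj_toFin (Finset.mem_singleton_self i) _).symm.trans ?_
  exact congrArg _ (hφ {i} x)

/-- The coalgebra morphism to a tensor product with given components. -/
def lift [Coalgebra.IsCocomm k E] (f : ∀ i, E →ₗc[k] C i) : E →ₗc[k] InfTensor k C :=
  (exists_lift f).choose

@[simp] lemma proj_lift [Coalgebra.IsCocomm k E] (f : ∀ i, E →ₗc[k] C i) (i : ι) (x : E) :
    proj k C i (lift f x) = f i x :=
  CoalgHom.congr_fun ((exists_lift f).choose_spec i) x

/-- Here `F` is the last stage of the inverse system, so `x_F` determines the whole family. For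
surjectivity, the restrictions out of stage `F` form a compatible family of coalgebra maps and
factor through `InfTensor`. -/
lemma toFin_bijective (F : Finset ι) (hF : ∀ i, i ∈ F) : Function.Bijective (toFin k C F) := by
  constructor
  · intro x y h
    refine ext_toFin fun G => ?_
    have hG : G ⊆ F := fun i _ => hF i
    rw [← restrict_toFin hG, h, restrict_toFin]
  · intro x
    have hG : ∀ G : Finset ι, G ⊆ F := fun G i _ => hF i
    let g : ∀ G, FinTensor k C F →ₗc[k] FinTensor k C G := fun G => restrictHom C (hG G)
    obtain ⟨φ, hφ⟩ := exists_hom_toFin g fun G G' h x => restrict_restrict h (hG G') x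
    exact ⟨φ x, (hφ F x).trans (restrict_self F x)⟩

end InfTensor

/-! ### Hopf algebra structures on a fixed coalgebra and their antipodes -/

namespace HopfStructure

variable {k : Type u} [Field k] {H : Type v} [AddCommGroup H] [Module k H] [Coalgebra k H]

/-- The ring underlying a Hopf algebra structure on a coalgebra. -/
abbrev ring (hs : HopfStructure k H) : Ring H :=
  { (inferInstance : AddCommGroup H) with
    mul := fun x y => hs.mul (x ⊗ₜ y)
    one := hs.unit 1
    mul_assoc := hs.mul_assoc
    one_mul := hs.one_mul
    mul_one := hs.mul_one
    zero_mul := fun x => by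
      change hs.mul (0 ⊗ₜ x) = 0
      simp
    mul_zero := fun x => by
      change hs.mul (x ⊗ₜ 0) = 0
      simp
    left_distrib := fun x y z => by
      change hs.mul (x ⊗ₜ (y + z)) = hs.mul (x ⊗ₜ y) + hs.mul (x ⊗ₜ z)
      rw [TensorProduct.tmul_add, map_add]
    right_distrib := fun x y z => by
      change hs.mul ((x + y) ⊗ₜ z) = hs.mul (x ⊗ₜ z) + hs.mul (y ⊗ₜ z)
      rw [TensorProduct.add_tmul, map_add] }

/-- The algebra underlying a Hopf algebra structure on a coalgebra. -/
abbrev algebra (hs : HopfStructure k H) : letI := hs.ring; Algebra k H :=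
  letI := hs.ring
  Algebra.ofModule
    (fun r x y => by
      change hs.mul ((r • x) ⊗ₜ y) = r • hs.mul (x ⊗ₜ y)
      rw [← TensorProduct.smul_tmul', map_smul])
    (fun r x y => by
      change hs.mul (x ⊗ₜ (r • y)) = r • hs.mul (x ⊗ₜ y)
      rw [TensorProduct.tmul_smul, map_smul])

lemma unit_apply (hs : HopfStructure k H) (r : k) : hs.unit r = r • hs.unit 1 := by
  rw [← map_smul, smul_eq_mul, _root_.mul_one]

lemma mul'_eq (hs : HopfStructure k H) : letI := hs.ring; letI := hs.algebra
    LinearMap.mul' k H = hs.mul.toLinearMap := by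
  let _ := hs.ring; let _ := hs.algebra
  ext x y
  rfl

/-- The bialgebra underlying a Hopf algebra structure on a coalgebra. -/
abbrev bialgebra (hs : HopfStructure k H) : letI := hs.ring; Bialgebra k H :=
  letI := hs.ring
  letI := hs.algebra
  Bialgebra.mk' k H
    (by
      change Coalgebra.counit (R := k) (hs.unit 1) = 1
      simp)
    (by
      intro x y
      change Coalgebra.counit (R := k) (hs.mul (x ⊗ₜ y)) = _
      simp [mul_comm])
    (by
      change Coalgebra.comul (R := k) (hs.unit 1) = hs.unit 1 ⊗ₜ hs.unit 1
      rw [← CoalgHomClass.map_comp_comul_apply]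
      simp)
    (by
      intro x y
      change Coalgebra.comul (R := k) (hs.mul (x ⊗ₜ y)) = _
      rw [← CoalgHomClass.map_comp_comul_apply, TensorProduct.comul_tmul,
        ← LinearMap.mul'_apply (R := k), LinearMap.mul'_tensor, mul'_eq]
      rfl)

/-- The Hopf algebra given by a Hopf algebra structure on a coalgebra. -/
abbrev hopfAlgebra (hs : HopfStructure k H) : letI := hs.ring; HopfAlgebra k H :=
  letI := hs.ring
  letI := hs.bialgebra
  { antipode := hs.antipode
    mul_antipode_rTensor_comul := by
      ext x
      change LinearMap.mul' k H (hs.antipode.rTensor H (Coalgebra.comul x)) =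
        algebraMap k H (Coalgebra.counit x)
      rw [mul'_eq, Algebra.algebraMap_eq_smul_one]
      have := hs.antipode_mul x
      rw [unit_apply] at this
      exact this
    mul_antipode_lTensor_comul := by
      ext x
      change LinearMap.mul' k H (hs.antipode.lTensor H (Coalgebra.comul x)) =
        algebraMap k H (Coalgebra.counit x)
      rw [mul'_eq, Algebra.algebraMap_eq_smul_one]
      have := hs.mul_antipode x
      rw [unit_apply] at this
      exact this }

/-- A morphism of Hopf algebras commutes with the antipodes. -/
lemma map_antipode {H' : Type*} [AddCommGroup H'] [Module k H'] [Coalgebra k H']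
    (hs : HopfStructure k H) (hs' : HopfStructure k H') (φ : H →ₗc[k] H')
    (hmul : ∀ x y, φ (hs.mul (x ⊗ₜ y)) = hs'.mul (φ x ⊗ₜ φ y))
    (hone : φ (hs.unit 1) = hs'.unit 1) (x : H) : φ (hs.antipode x) = hs'.antipode (φ x) := by
  let _ := hs.ring
  let _ := hs.hopfAlgebra
  let _ := hs'.ring
  let _ := hs'.hopfAlgebra
  let ψ : H →ₐ[k] H' := AlgHom.ofLinearMap φ.toLinearMap hone hmul
  -- In the convolution algebra of maps `H → H'`, `φ ∘ S` is a left inverse and `S' ∘ φ` a right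
  -- inverse of `φ`; hence they coincide.
  have h₁ : WithConv.toConv (ψ.toLinearMap ∘ₗ HopfAlgebra.antipode k (A := H)) *
      WithConv.toConv ψ.toLinearMap = 1 := by
    have := LinearMap.algHom_comp_convMul_distrib ψ
      (WithConv.toConv (HopfAlgebra.antipode k (A := H))) (WithConv.toConv LinearMap.id)
    rw [LinearMap.antipode_mul_id] at this
    refine (congrArg WithConv.toConv this).symm.trans ?_
    ext y
    simp [LinearMap.convOne_def]
  have h₂ : WithConv.toConv ψ.toLinearMap *
      WithConv.toConv (HopfAlgebra.antipode k (A := H') ∘ₗ φ.toLinearMap) = 1 := by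
    have := LinearMap.convMul_comp_coalgHom_distrib (WithConv.toConv LinearMap.id)
      (WithConv.toConv (HopfAlgebra.antipode k (A := H'))) φ
    rw [LinearMap.id_mul_antipode] at this
    refine (congrArg WithConv.toConv this).symm.trans ?_
    ext y
    simp [LinearMap.convOne_def]
  exact LinearMap.congr_fun (congrArg WithConv.ofConv (left_inv_eq_right_inv h₁ h₂)) x

-- The antipode is determined by the rest of the structure: apply `map_antipode` to the identity.
@[ext]
lemma ext {hs hs' : HopfStructure k H} (hmul : hs.mul = hs'.mul) (hunit : hs.unit = hs'.unit) :
    hs = hs' := by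
  have h : hs.antipode = hs'.antipode := LinearMap.ext fun x =>
    map_antipode hs hs' (CoalgHom.id k H) (by simp [hmul]) (by simp [hunit]) x
  cases hs
  cases hs'
  congr

/-- The antipode of a cocommutative Hopf algebra is a morphism of coalgebras. -/
def antipodeHom [Coalgebra.IsCocomm k H] (hs : HopfStructure k H) : H →ₗc[k] H where
  toLinearMap := hs.antipode
  counit_comp := by
    let _ := hs.ring
    let _ := hs.hopfAlgebra
    exact HopfAlgebra.counit_comp_antipode (R := k) (A := H)
  map_comp_comul := by
    let _ := hs.ring
    let _ := hs.hopfAlgebra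
    -- Both `(S ⊗ S) ∘ Δ` and `Δ ∘ S` are convolution inverses of `Δ`. For the first, pull `(S ⊗ S)
    -- * (id ⊗ id) = (S * id) ⊗ (S * id)` back along `Δ`; this respects convolution because `Δ` is a
    -- coalgebra map, by cocommutativity.
    have h₁ : WithConv.toConv (TensorProduct.map hs.antipode hs.antipode ∘ₗ
        Coalgebra.comul (R := k) (A := H)) * WithConv.toConv (Coalgebra.comul (R := k) (A := H)) =
        1 := by
      have e := TensorProduct.map_convMul_map
        (f := WithConv.toConv (HopfAlgebra.antipode k (A := H)))
        (h := WithConv.toConv LinearMap.id)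
        (g := WithConv.toConv (HopfAlgebra.antipode k (A := H)))
        (k := WithConv.toConv LinearMap.id)
      rw [LinearMap.antipode_mul_id] at e
      have := LinearMap.convMul_comp_coalgHom_distrib
        (WithConv.toConv (TensorProduct.map hs.antipode hs.antipode))
        (WithConv.toConv (TensorProduct.map LinearMap.id LinearMap.id))
        (Coalgebra.comulCoalgHom k H)
      have e' := (congrArg (fun t : WithConv (H ⊗[k] H →ₗ[k] H ⊗[k] H) =>
        t.ofConv ∘ₗ (Coalgebra.comulCoalgHom k H).toLinearMap) e).symm.trans this
      suffices h : WithConv.toConv (TensorProduct.map hs.antipode hs.antipode ∘ₗ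
          Coalgebra.comul (R := k) (A := H)) * WithConv.toConv (TensorProduct.map LinearMap.id
            LinearMap.id ∘ₗ Coalgebra.comul (R := k) (A := H)) = 1 by
        simpa only [TensorProduct.map_id, LinearMap.id_comp] using h
      refine (congrArg WithConv.toConv e').symm.trans ?_
      ext x
      change TensorProduct.map (Algebra.linearMap k H ∘ₗ Coalgebra.counit)
        (Algebra.linearMap k H ∘ₗ Coalgebra.counit) (Coalgebra.comul (R := k) x) =
          algebraMap k (H ⊗[k] H) (Coalgebra.counit x)
      have hx : TensorProduct.map Coalgebra.counit Coalgebra.counit (Coalgebra.comul (R := k) x) =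
          (1 : k) ⊗ₜ[k] Coalgebra.counit (R := k) x := by
        rw [← LinearMap.lTensor_comp_rTensor, LinearMap.comp_apply,
          Coalgebra.rTensor_counit_comul, LinearMap.lTensor_tmul]
      rw [TensorProduct.map_comp, LinearMap.comp_apply, hx]
      simp [Algebra.TensorProduct.one_def, Algebra.algebraMap_eq_smul_one, TensorProduct.smul_tmul']
    exact congrArg WithConv.ofConv
      (left_inv_eq_right_inv h₁ (LinearMap.comul_right_inv (R := k) (C := H)))

/-! ### Transfer of Hopf algebra structures along jointly monic families -/

section JointlyMonic

variable {D : Type v} [AddCommGroup D] [Module k D] [Coalgebra k D] [Coalgebra.IsCocomm k D]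
  {ι : Type*} {X : ι → Type*} [∀ i, AddCommGroup (X i)] [∀ i, Module k (X i)]
  [∀ i, Coalgebra k (X i)]

/-- A family of coalgebra morphisms out of `D` which is jointly monic in coalgebras. -/
def JointlyMonic (p : ∀ i, D →ₗc[k] X i) : Prop :=
  ∀ (E : Type v) [AddCommGroup E] [Module k E] [Coalgebra k E] (f g : E →ₗc[k] D),
    (∀ i, (p i).toLinearMap ∘ₗ f.toLinearMap = (p i).toLinearMap ∘ₗ g.toLinearMap) → f = g

/-- Coalgebra maps on `D` compatible with the structure maps of Hopf algebras along a jointly monic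
family of coalgebra morphisms define a Hopf algebra structure. -/
def ofJointlyMonic (hs : ∀ i, HopfStructure k (X i)) {p : ∀ i, D →ₗc[k] X i}
    (hp : JointlyMonic p) (m : D ⊗[k] D →ₗc[k] D) (u : k →ₗc[k] D) (s : D →ₗc[k] D)
    (hm : ∀ i x y, p i (m (x ⊗ₜ y)) = (hs i).mul (p i x ⊗ₜ p i y))
    (hu : ∀ i, p i (u 1) = (hs i).unit 1)
    (hs' : ∀ i x, p i (s x) = (hs i).antipode (p i x)) : HopfStructure k D :=
  have hu' : ∀ i r, p i (u r) = (hs i).unit r := fun i r => by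
    have h : u r = r • u 1 := by rw [← map_smul, smul_eq_mul, _root_.mul_one]
    rw [h, map_smul, hu, ← unit_apply]
  { mul := m
    unit := u
    antipode := s.toLinearMap
    mul_assoc := fun x y z => by
      -- The two bracketings are compared as coalgebra maps on `(D ⊗ D) ⊗ D`, where joint monicity
      -- applies; after `p i` the identity is associativity in `X i`.
      have h := hp _ (m.comp (Coalgebra.TensorProduct.map m (CoalgHom.id k D)))
        (m.comp ((Coalgebra.TensorProduct.map (CoalgHom.id k D) m).comp
          (Coalgebra.TensorProduct.assoc k k D D D).toCoalgHom)) fun i => by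
            refine TensorProduct.ext_threefold fun x y z => ?_
            refine (hm i _ z).trans (Eq.trans ?_ (hm i x _).symm)
            exact (congrArg (fun t => (hs i).mul (t ⊗ₜ p i z)) (hm i x y)).trans
              (((hs i).mul_assoc _ _ _).trans
                (congrArg (fun t => (hs i).mul (p i x ⊗ₜ t)) (hm i y z)).symm)
      exact CoalgHom.congr_fun h ((x ⊗ₜ y) ⊗ₜ z)
    one_mul := fun x => by
      have h := hp _ (m.comp ((Coalgebra.TensorProduct.map u (CoalgHom.id k D)).comp
        (Coalgebra.TensorProduct.lid k D).symm.toCoalgHom)) (CoalgHom.id k D) fun i => by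
          ext x
          exact (hm i _ _).trans ((congrArg (fun t => (hs i).mul (t ⊗ₜ p i x)) (hu i)).trans
            ((hs i).one_mul _))
      exact CoalgHom.congr_fun h x
    mul_one := fun x => by
      have h := hp _ (m.comp ((Coalgebra.TensorProduct.map (CoalgHom.id k D) u).comp
        (Coalgebra.TensorProduct.rid k k D).symm.toCoalgHom)) (CoalgHom.id k D) fun i => by
          ext x
          exact (hm i _ _).trans ((congrArg (fun t => (hs i).mul (p i x ⊗ₜ t)) (hu i)).trans
            ((hs i).mul_one _))
      exact CoalgHom.congr_fun h x
    antipode_mul := fun x => by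
      -- The convolution of `s` with the identity is a coalgebra map because `s` is one and, `D`
      -- being cocommutative, so is `Δ`.
      have h := hp _ (m.comp ((Coalgebra.TensorProduct.map s (CoalgHom.id k D)).comp
        (Coalgebra.comulCoalgHom k D))) (u.comp (Coalgebra.counitCoalgHom k D)) fun i => by
          have e : (p i).toLinearMap ∘ₗ m.toLinearMap ∘ₗ
              TensorProduct.map s.toLinearMap LinearMap.id = (hs i).mul.toLinearMap ∘ₗ
                (hs i).antipode.rTensor _ ∘ₗ
                  TensorProduct.map (p i).toLinearMap (p i).toLinearMap :=
            TensorProduct.ext' fun x y => by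
              simp [hm, hs']
          ext x
          refine (LinearMap.congr_fun e (Coalgebra.comul (R := k) x)).trans ?_
          refine Eq.trans ?_ (hu' i _).symm
          change _ = (hs i).unit (Coalgebra.counit (R := k) x)
          rw [← CoalgHomClass.counit_comp_apply (p i), ← antipode_mul,
            ← CoalgHomClass.map_comp_comul_apply]
          rfl
      exact CoalgHom.congr_fun h x
    mul_antipode := fun x => by
      have h := hp _ (m.comp ((Coalgebra.TensorProduct.map (CoalgHom.id k D) s).comp
        (Coalgebra.comulCoalgHom k D))) (u.comp (Coalgebra.counitCoalgHom k D)) fun i => by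
          have e : (p i).toLinearMap ∘ₗ m.toLinearMap ∘ₗ
              TensorProduct.map LinearMap.id s.toLinearMap = (hs i).mul.toLinearMap ∘ₗ
                (hs i).antipode.lTensor _ ∘ₗ
                  TensorProduct.map (p i).toLinearMap (p i).toLinearMap :=
            TensorProduct.ext' fun x y => by
              simp [hm, hs']
          ext x
          refine (LinearMap.congr_fun e (Coalgebra.comul (R := k) x)).trans ?_
          refine Eq.trans ?_ (hu' i _).symm
          change _ = (hs i).unit (Coalgebra.counit (R := k) x)
          rw [← CoalgHomClass.counit_comp_apply (p i), ← mul_antipode,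
            ← CoalgHomClass.map_comp_comul_apply]
          rfl
      exact CoalgHom.congr_fun h x }

end JointlyMonic

end HopfStructure

/-! ### Transfer of the brace compatibility condition -/

namespace HopfBrace

variable {k : Type u} [Field k]

section Rearrange

variable (k) (A B C D : Type*) [AddCommGroup A] [Module k A] [Coalgebra k A]
  [AddCommGroup B] [Module k B] [Coalgebra k B] [AddCommGroup C] [Module k C] [Coalgebra k C]
  [AddCommGroup D] [Module k D] [Coalgebra k D]

/-- The exchange of the middle factors `(A ⊗ B) ⊗ (C ⊗ D) → (A ⊗ C) ⊗ (B ⊗ D)` as a morphism of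
coalgebras. -/
def exchange : (A ⊗[k] B) ⊗[k] (C ⊗[k] D) →ₗc[k] (A ⊗[k] C) ⊗[k] (B ⊗[k] D) where
  toLinearMap := (TensorProduct.tensorTensorTensorComm k A B C D).toLinearMap
  counit_comp := by
    ext a b c d
    simp [mul_comm, mul_left_comm, mul_assoc]
  map_comp_comul := by
    refine TensorProduct.ext_fourfold' fun a b c d => ?_
    simp only [LinearMap.comp_apply, LinearEquiv.coe_coe, TensorProduct.comul_tmul,
      TensorProduct.tensorTensorTensorComm_tmul]
    -- Both sides are linear in each of the four coproducts, which may thus be replaced by pure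
    -- tensors.
    induction Coalgebra.comul (R := k) a using TensorProduct.induction_on with
    | zero => simp
    | add _ _ h h' => simp only [TensorProduct.add_tmul, map_add, h, h']
    | tmul a a' =>
    induction Coalgebra.comul (R := k) b using TensorProduct.induction_on with
    | zero => simp
    | add _ _ h h' => simp only [TensorProduct.add_tmul, TensorProduct.tmul_add, map_add, h, h']
    | tmul b b' =>
    induction Coalgebra.comul (R := k) c using TensorProduct.induction_on with
    | zero => simp
    | add _ _ h h' => simp only [TensorProduct.add_tmul, TensorProduct.tmul_add, map_add, h, h']
    | tmul c c' =>
    induction Coalgebra.comul (R := k) d using TensorProduct.induction_on with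
    | zero => simp
    | add _ _ h h' => simp only [TensorProduct.tmul_add, map_add, h, h']
    | tmul d d' => simp

/-- The exchange of factors `(A ⊗ B) ⊗ C → (A ⊗ C) ⊗ B` as a morphism of coalgebras. -/
def exchangeRight : (A ⊗[k] B) ⊗[k] C →ₗc[k] (A ⊗[k] C) ⊗[k] B where
  toLinearMap := (TensorProduct.rightComm k A B C).toLinearMap
  counit_comp := by
    ext a b c
    simp [mul_comm, mul_left_comm, mul_assoc]
  map_comp_comul := by
    refine TensorProduct.ext_threefold fun a b c => ?_
    simp only [LinearMap.comp_apply, LinearEquiv.coe_coe, TensorProduct.comul_tmul,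
      TensorProduct.rightComm_tmul]
    induction Coalgebra.comul (R := k) a using TensorProduct.induction_on with
    | zero => simp
    | add _ _ h h' => simp only [TensorProduct.add_tmul, map_add, h, h']
    | tmul a a' =>
    induction Coalgebra.comul (R := k) b using TensorProduct.induction_on with
    | zero => simp
    | add _ _ h h' => simp only [TensorProduct.add_tmul, TensorProduct.tmul_add, map_add, h, h']
    | tmul b b' =>
    induction Coalgebra.comul (R := k) c using TensorProduct.induction_on with
    | zero => simp
    | add _ _ h h' => simp only [TensorProduct.add_tmul, TensorProduct.tmul_add, map_add, h, h']
    | tmul c c' => simp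

end Rearrange

section JointlyMonic

open HopfStructure

/-- The right hand side `(x₍₁₎ ∘ y) S(x₍₂₎) (x₍₃₎ ∘ z)` of the compatibility condition of a Hopf
brace, as a function of `(x₍₁₎ ⊗ x₍₂₎) ⊗ x₍₃₎`. -/
def compatRHS {H : Type*} [AddCommGroup H] [Module k H] (c m : H ⊗[k] H →ₗ[k] H) (s : H →ₗ[k] H)
    (y z : H) : (H ⊗[k] H) ⊗[k] H →ₗ[k] H :=
  m ∘ₗ TensorProduct.map
    (m ∘ₗ TensorProduct.map (c ∘ₗ (TensorProduct.mk k H H).flip y) s)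
    (c ∘ₗ (TensorProduct.mk k H H).flip z)

lemma map_compatRHS {H H' : Type*} [AddCommGroup H] [Module k H] [AddCommGroup H'] [Module k H']
    {c m : H ⊗[k] H →ₗ[k] H} {s : H →ₗ[k] H} {c' m' : H' ⊗[k] H' →ₗ[k] H'} {s' : H' →ₗ[k] H'}
    (p : H →ₗ[k] H') (hc : ∀ x y, p (c (x ⊗ₜ y)) = c' (p x ⊗ₜ p y))
    (hm : ∀ x y, p (m (x ⊗ₜ y)) = m' (p x ⊗ₜ p y)) (hs : ∀ x, p (s x) = s' (p x))
    (y z : H) (w : (H ⊗[k] H) ⊗[k] H) :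
    p (compatRHS c m s y z w) =
      compatRHS c' m' s' (p y) (p z) (TensorProduct.map (TensorProduct.map p p) p w) := by
  suffices h : p ∘ₗ compatRHS c m s y z = compatRHS c' m' s' (p y) (p z) ∘ₗ
      TensorProduct.map (TensorProduct.map p p) p from LinearMap.congr_fun h w
  refine TensorProduct.ext_threefold fun x₁ x₂ x₃ => ?_
  simp [compatRHS, hc, hm, hs]

variable {D : Type v} [AddCommGroup D] [Module k D] [Coalgebra k D] [Coalgebra.IsCocomm k D]

variable (k D) in
/-- The twofold comultiplication of a cocommutative coalgebra as a morphism of coalgebras. -/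
def comul₂ : D →ₗc[k] (D ⊗[k] D) ⊗[k] D :=
  (Coalgebra.TensorProduct.map (Coalgebra.comulCoalgHom k D) (CoalgHom.id k D)).comp
    (Coalgebra.comulCoalgHom k D)

lemma comul₂_apply (x : D) :
    comul₂ k D x = Coalgebra.comul.rTensor D (Coalgebra.comul (R := k) x) := rfl

lemma map_comul₂ {H : Type*} [AddCommGroup H] [Module k H] [Coalgebra k H] (p : D →ₗc[k] H)
    (x : D) : TensorProduct.map (TensorProduct.map p.toLinearMap p.toLinearMap) p.toLinearMap
      (comul₂ k D x) = Coalgebra.comul.rTensor H (Coalgebra.comul (R := k) (p x)) := by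
  rw [comul₂_apply, ← LinearMap.comp_apply, LinearMap.map_comp_rTensor, p.map_comp_comul,
    ← LinearMap.rTensor_comp_map, LinearMap.comp_apply]
  exact congrArg _ (CoalgHomClass.map_comp_comul_apply p x)

/-- The right hand side of the compatibility condition of a Hopf brace, as a morphism of
coalgebras. -/
def compatHom (c m : D ⊗[k] D →ₗc[k] D) (s : D →ₗc[k] D) : D ⊗[k] (D ⊗[k] D) →ₗc[k] D :=
  m.comp ((Coalgebra.TensorProduct.map
    (m.comp ((Coalgebra.TensorProduct.map c s).comp (exchangeRight k D D D))) c).comp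
      ((exchange k (D ⊗[k] D) D D D).comp
        (Coalgebra.TensorProduct.map (comul₂ k D) (CoalgHom.id k (D ⊗[k] D)))))

/-- The exchanges turn `((x₁ ⊗ x₂) ⊗ x₃) ⊗ (y ⊗ z)` into `((x₁ ⊗ y) ⊗ x₂) ⊗ (x₃ ⊗ z)`, to which the
operations are applied. By linearity in the twofold coproduct of `x`, pure tensors suffice. -/
lemma compatHom_apply (c m : D ⊗[k] D →ₗc[k] D) (s : D →ₗc[k] D) (x y z : D) :
    compatHom c m s (x ⊗ₜ (y ⊗ₜ z)) =
      compatRHS c.toLinearMap m.toLinearMap s.toLinearMap y z (comul₂ k D x) := by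
  have h : ∀ w : (D ⊗[k] D) ⊗[k] D, m (Coalgebra.TensorProduct.map
      (m.comp ((Coalgebra.TensorProduct.map c s).comp (exchangeRight k D D D))) c
        (exchange k (D ⊗[k] D) D D D (w ⊗ₜ (y ⊗ₜ z)))) =
      compatRHS c.toLinearMap m.toLinearMap s.toLinearMap y z w := fun w => by
    induction w using TensorProduct.induction_on with
    | zero => simp
    | add _ _ h h' => simp only [TensorProduct.add_tmul, map_add, h, h']
    | tmul w x₃ =>
    induction w using TensorProduct.induction_on with
    | zero => simp
    | add _ _ h h' => simp only [TensorProduct.add_tmul, map_add, h, h']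
    | tmul x₁ x₂ => rfl
  exact h _

variable {ι : Type*} {X : ι → Type*} [∀ i, AddCommGroup (X i)] [∀ i, Module k (X i)]
  [∀ i, Coalgebra k (X i)]

/-- Two Hopf algebra structures on `D` compatible with the structure maps of Hopf braces along a
jointly monic family of coalgebra morphisms define a Hopf brace. -/
def ofJointlyMonic (B : ∀ i, HopfBrace k (X i)) {p : ∀ i, D →ₗc[k] X i} (hp : JointlyMonic p)
    (dot circ : HopfStructure k D)
    (hd : ∀ i x y, p i (dot.mul (x ⊗ₜ y)) = (B i).dot.mul (p i x ⊗ₜ p i y))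
    (hs : ∀ i x, p i (dot.antipode x) = (B i).dot.antipode (p i x))
    (hc : ∀ i x y, p i (circ.mul (x ⊗ₜ y)) = (B i).circ.mul (p i x ⊗ₜ p i y)) :
    HopfBrace k D where
  dot := dot
  circ := circ
  compat x y z := by
    -- The arguments `y` and `z` are kept as tensor factors of the source, since fixing them would
    -- in general not leave coalgebra maps in `x`.
    have h := hp _ (circ.mul.comp (Coalgebra.TensorProduct.map (CoalgHom.id k D) dot.mul))
      (compatHom circ.mul dot.mul dot.antipodeHom) fun i => by
        refine TensorProduct.ext' fun x w => ?_
        induction w using TensorProduct.induction_on with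
        | zero => simp
        | add _ _ h h' => simp only [TensorProduct.tmul_add, map_add, h, h']
        | tmul y z =>
        have e₁ : p i (compatHom circ.mul dot.mul dot.antipodeHom (x ⊗ₜ (y ⊗ₜ z))) =
            compatRHS (B i).circ.mul.toLinearMap (B i).dot.mul.toLinearMap (B i).dot.antipode
              (p i y) (p i z) (Coalgebra.comul.rTensor _ (Coalgebra.comul (R := k) (p i x))) := by
          rw [compatHom_apply, ← map_comul₂]
          exact map_compatRHS (p i).toLinearMap (hc i) (hd i) (hs i) y z _
        refine Eq.trans ?_ e₁.symm
        refine ((hc i _ _).trans ?_).trans ((B i).compat _ _ _)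
        exact congrArg (fun t => (B i).circ.mul (p i x ⊗ₜ t)) (hd i y z)
    exact (CoalgHom.congr_fun h (x ⊗ₜ (y ⊗ₜ z))).trans (compatHom_apply _ _ _ x y z)

end JointlyMonic

end HopfBrace

/-! ### Equalizers of coalgebra maps -/

section Equalizer

variable {k : Type u} [Field k] {X : Type v} {Y : Type w} [AddCommGroup X] [Module k X]
  [Coalgebra k X] [AddCommGroup Y] [Module k Y] [Coalgebra k Y]

/-- A subspace of a coalgebra to which the comultiplication restricts. -/
def IsComulStable (D : Submodule k X) : Prop :=
  ∀ x ∈ D, Coalgebra.comul (R := k) x ∈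
    LinearMap.range (TensorProduct.map D.subtype D.subtype)

/-- The vectors whose coproduct lies in the image of the tensor square of the supremum form a
subspace, so it suffices that this subspace contains each member of `S`. -/
lemma isComulStable_sSup {S : Set (Submodule k X)} (hS : ∀ D ∈ S, IsComulStable D) :
    IsComulStable (sSup S) := by
  have h : sSup S ≤ (LinearMap.range (TensorProduct.map (sSup S).subtype (sSup S).subtype)).comap
      (Coalgebra.comul (R := k) (A := X)) := sSup_le fun D hD x hx => by
    obtain ⟨z, hz⟩ := hS D hD x hx
    have hle : D ≤ sSup S := le_sSup hD
    refine ⟨TensorProduct.map (Submodule.inclusion hle) (Submodule.inclusion hle) z, ?_⟩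
    rw [← hz, ← LinearMap.comp_apply, ← TensorProduct.map_comp]
    rfl
  exact fun x hx => h hx

/-- The largest subcoalgebra on which two coalgebra morphisms agree. -/
def coalgEqLocus (f g : X →ₗc[k] Y) : Submodule k X :=
  sSup {D | IsComulStable D ∧ ∀ x ∈ D, f x = g x}

lemma isComulStable_coalgEqLocus (f g : X →ₗc[k] Y) : IsComulStable (coalgEqLocus f g) :=
  isComulStable_sSup fun _ hD => hD.1

/-- The equalizer of two coalgebra morphisms. -/
def CoalgEqualizer (f g : X →ₗc[k] Y) : Type v := coalgEqLocus f g

namespace CoalgEqualizer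

variable (f g : X →ₗc[k] Y)

instance : AddCommGroup (CoalgEqualizer f g) := inferInstanceAs (AddCommGroup (coalgEqLocus f g))
instance : Module k (CoalgEqualizer f g) := inferInstanceAs (Module k (coalgEqLocus f g))

/-- The inclusion of the equalizer of two coalgebra morphisms as a linear map. -/
def incl : CoalgEqualizer f g →ₗ[k] X := (coalgEqLocus f g).subtype

lemma incl_injective : Function.Injective (incl f g) := Subtype.val_injective

/-- Vector spaces are flat. Hence the restricted coproduct is unique, and the choice made in
defining it is linear. -/
lemma incl₂_injective : Function.Injective (TensorProduct.map (incl f g) (incl f g)) :=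
  TensorProduct.map_injective_of_flat_flat _ _ (incl_injective f g) (incl_injective f g)

lemma incl_eq (x : CoalgEqualizer f g) : f (incl f g x) = g (incl f g x) := by
  have h : coalgEqLocus f g ≤ LinearMap.eqLocus f.toLinearMap g.toLinearMap :=
    sSup_le fun D hD x hx => hD.2 x hx
  exact h x.2

lemma exists_comul (x : CoalgEqualizer f g) :
    ∃ z, TensorProduct.map (incl f g) (incl f g) z = Coalgebra.comul (R := k) (incl f g x) :=
  isComulStable_coalgEqLocus f g x.1 x.2

instance : CoalgebraStruct k (CoalgEqualizer f g) where
  comul :=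
    { toFun := fun x => (exists_comul f g x).choose
      map_add' := fun x y => incl₂_injective f g <| by
        rw [map_add (TensorProduct.map _ _), (exists_comul f g _).choose_spec, (exists_comul f g _).choose_spec,
          (exists_comul f g _).choose_spec, map_add, map_add]
      map_smul' := fun r x => incl₂_injective f g <| by
        rw [RingHom.id_apply, (exists_comul f g (r • x)).choose_spec,
          map_smul (TensorProduct.map (incl f g) (incl f g)), (exists_comul f g x).choose_spec,
          map_smul, map_smul] }
  counit := Coalgebra.counit ∘ₗ incl f g

lemma map_incl_comp_comul : TensorProduct.map (incl f g) (incl f g) ∘ₗ CoalgebraStruct.comul =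
    Coalgebra.comul (R := k) ∘ₗ incl f g :=
  LinearMap.ext fun x => (exists_comul f g x).choose_spec

instance : Coalgebra k (CoalgEqualizer f g) where
  coassoc := by
    have h := map_incl_comp_comul f g
    have inj : Function.Injective (TensorProduct.map (incl f g)
        (TensorProduct.map (incl f g) (incl f g))) :=
      TensorProduct.map_injective_of_flat_flat _ _ (incl_injective f g) (incl₂_injective f g)
    -- Coassociativity is checked inside the triple tensor power of `X`, where it is known.
    refine (LinearMap.cancel_left inj).1 ?_
    have e₁ : TensorProduct.map (TensorProduct.map (incl f g) (incl f g)) (incl f g) ∘ₗ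
        CoalgebraStruct.comul.rTensor _ = Coalgebra.comul.rTensor _ ∘ₗ
          TensorProduct.map (incl f g) (incl f g) := by
      rw [LinearMap.map_comp_rTensor, LinearMap.rTensor_comp_map, h]
    have e₂ : TensorProduct.map (incl f g) (TensorProduct.map (incl f g) (incl f g)) ∘ₗ
        CoalgebraStruct.comul.lTensor _ = Coalgebra.comul.lTensor _ ∘ₗ
          TensorProduct.map (incl f g) (incl f g) := by
      rw [LinearMap.map_comp_lTensor, LinearMap.lTensor_comp_map, h]
    ext x
    have e₃ := LinearMap.congr_fun (TensorProduct.map_map_comp_assoc_eq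
      (incl f g) (incl f g) (incl f g)) (CoalgebraStruct.comul.rTensor _ (CoalgebraStruct.comul x))
    have e₁' := LinearMap.congr_fun e₁ (CoalgebraStruct.comul x)
    have e₂' := LinearMap.congr_fun e₂ (CoalgebraStruct.comul x)
    have h' := LinearMap.congr_fun h x
    simp only [LinearMap.comp_apply, LinearEquiv.coe_coe] at e₁' e₂' e₃ h' ⊢
    rw [e₃, e₁', e₂', h', Coalgebra.coassoc_apply]
  rTensor_counit_comp_comul := by
    have h := map_incl_comp_comul f g
    refine (LinearMap.cancel_left (Module.Flat.lTensor_preserves_injective_linearMap (M := k) _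
      (incl_injective f g))).1 ?_
    have e : (incl f g).lTensor k ∘ₗ (Coalgebra.counit ∘ₗ incl f g).rTensor _ =
        Coalgebra.counit.rTensor _ ∘ₗ TensorProduct.map (incl f g) (incl f g) := by
      rw [LinearMap.lTensor_comp_rTensor, LinearMap.rTensor_comp_map]
    rw [← LinearMap.comp_assoc]
    refine (congrArg (· ∘ₗ CoalgebraStruct.comul) e).trans ?_
    rw [LinearMap.comp_assoc, h]
    ext x
    simp
  lTensor_counit_comp_comul := by
    have h := map_incl_comp_comul f g
    refine (LinearMap.cancel_left (Module.Flat.rTensor_preserves_injective_linearMap (M := k) _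
      (incl_injective f g))).1 ?_
    have e : (incl f g).rTensor k ∘ₗ (Coalgebra.counit ∘ₗ incl f g).lTensor _ =
        Coalgebra.counit.lTensor _ ∘ₗ TensorProduct.map (incl f g) (incl f g) := by
      rw [LinearMap.rTensor_comp_lTensor, LinearMap.lTensor_comp_map]
    rw [← LinearMap.comp_assoc]
    refine (congrArg (· ∘ₗ CoalgebraStruct.comul) e).trans ?_
    rw [LinearMap.comp_assoc, h]
    ext x
    simp

/-- The inclusion of the equalizer of two coalgebra morphisms. -/
def ι : CoalgEqualizer f g →ₗc[k] X where
  toLinearMap := incl f g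
  counit_comp := rfl
  map_comp_comul := map_incl_comp_comul f g

lemma ι_injective : Function.Injective (ι f g) := incl_injective f g

lemma condition (x : CoalgEqualizer f g) : f (ι f g x) = g (ι f g x) := incl_eq f g x

instance [Coalgebra.IsCocomm k X] : Coalgebra.IsCocomm k (CoalgEqualizer f g) where
  comm_comp_comul := by
    refine (LinearMap.cancel_left (incl₂_injective f g)).1 ?_
    have e : TensorProduct.map (incl f g) (incl f g) ∘ₗ
        (TensorProduct.comm k (CoalgEqualizer f g) (CoalgEqualizer f g)).toLinearMap =
        (TensorProduct.comm k X X).toLinearMap ∘ₗ TensorProduct.map (incl f g) (incl f g) :=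
      TensorProduct.ext rfl
    rw [← LinearMap.comp_assoc, e, LinearMap.comp_assoc, map_incl_comp_comul,
      ← LinearMap.comp_assoc, Coalgebra.comm_comp_comul]

variable {f g} {E : Type*} [AddCommGroup E] [Module k E] [Coalgebra k E]

/-- A coalgebra morphism equalizing `f` and `g` factors through their equalizer. -/
def lift (φ : E →ₗc[k] X) (h : ∀ x, f (φ x) = g (φ x)) : E →ₗc[k] CoalgEqualizer f g :=
  have hmem : ∀ x, φ.toLinearMap x ∈ coalgEqLocus f g := fun x => by
    -- The range of `φ` is itself a subcoalgebra on which `f` and `g` agree, so it lies in the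
    -- largest one.
    refine le_sSup (show LinearMap.range φ.toLinearMap ∈ {D | IsComulStable D ∧ _} from ⟨?_, ?_⟩)
      ⟨x, rfl⟩
    · rintro _ ⟨y, rfl⟩
      refine ⟨TensorProduct.map φ.toLinearMap.rangeRestrict φ.toLinearMap.rangeRestrict
        (Coalgebra.comul (R := k) y), ?_⟩
      rw [← LinearMap.comp_apply, ← TensorProduct.map_comp]
      exact CoalgHomClass.map_comp_comul_apply φ y
    · rintro _ ⟨y, rfl⟩
      exact h y
  let ψ : E →ₗ[k] CoalgEqualizer f g := φ.toLinearMap.codRestrict (coalgEqLocus f g) hmem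
  have hψ : incl f g ∘ₗ ψ = φ.toLinearMap := rfl
  { toLinearMap := ψ
    counit_comp := φ.counit_comp
    map_comp_comul := by
      refine (LinearMap.cancel_left (incl₂_injective f g)).1 ?_
      rw [← LinearMap.comp_assoc, ← TensorProduct.map_comp, hψ, φ.map_comp_comul,
        ← LinearMap.comp_assoc, map_incl_comp_comul, LinearMap.comp_assoc, hψ] }

open HopfStructure

-- The inclusion is injective, hence monic on its own. Viewed as a family indexed by `Unit`, it
-- falls under the same transfer results as the projections of a product.
variable (f g) in
lemma jointlyMonic_ι : JointlyMonic (k := k) fun _ : Unit => ι f g :=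
  fun _ _ _ _ _ _ h => CoalgHom.ext fun x => ι_injective f g (LinearMap.congr_fun (h ()) x)

/-- The Hopf algebra structure on the equalizer of two morphisms of Hopf algebras. -/
def hopfStructure [Coalgebra.IsCocomm k X] (hs : HopfStructure k X) (ht : HopfStructure k Y)
    (hf : ∀ x y, f (hs.mul (x ⊗ₜ y)) = ht.mul (f x ⊗ₜ f y))
    (hg : ∀ x y, g (hs.mul (x ⊗ₜ y)) = ht.mul (g x ⊗ₜ g y))
    (hf₁ : f (hs.unit 1) = ht.unit 1) (hg₁ : g (hs.unit 1) = ht.unit 1) :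
    HopfStructure k (CoalgEqualizer f g) :=
  ofJointlyMonic (fun _ : Unit => hs) (jointlyMonic_ι f g)
    (lift (hs.mul.comp (Coalgebra.TensorProduct.map (ι f g) (ι f g))) fun w => by
      induction w using TensorProduct.induction_on with
      | zero => simp
      | add _ _ h h' => simp only [map_add, h, h']
      | tmul x y =>
        refine (hf _ _).trans (Eq.trans ?_ (hg _ _).symm)
        exact congrArg₂ (fun a b => ht.mul (a ⊗ₜ b)) (condition f g x) (condition f g y))
    (lift hs.unit fun r => by
      rw [unit_apply, map_smul, map_smul, hf₁, hg₁])
    -- No hypothesis on antipodes is needed: `f` and `g` commute with them by `map_antipode`.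
    (lift (hs.antipodeHom.comp (ι f g)) fun x => by
      refine (map_antipode hs ht f hf hf₁ _).trans
        (Eq.trans ?_ (map_antipode hs ht g hg hg₁ _).symm)
      exact congrArg _ (condition f g x))
    (fun _ _ _ => rfl) (fun _ => rfl) (fun _ _ => rfl)

end CoalgEqualizer

end Equalizer

namespace CocommHopfBraceCat

open HopfStructure

variable {k : Type u} [Field k]

/-! ### The brace structure on a tensor product -/

section Tensor

variable {ι : Type w} (H : ι → CocommHopfBraceCat.{u, v} k)

lemma jointlyMonic_proj : JointlyMonic (k := k) fun i => InfTensor.proj k (fun i => H i) i :=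
  fun _ _ _ _ _ _ h => InfTensor.hom_ext fun i => CoalgHom.coe_linearMap_injective (h i)

/-- The Hopf algebra structure on a tensor product of cocommutative Hopf algebras. -/
def tensorHopf (hs : ∀ i, HopfStructure k (H i)) : HopfStructure k (InfTensor k fun i => H i) :=
  let p := InfTensor.proj k fun i => H i
  ofJointlyMonic hs (jointlyMonic_proj H)
    (InfTensor.lift fun i => (hs i).mul.comp (Coalgebra.TensorProduct.map (p i) (p i)))
    (InfTensor.lift fun i => (hs i).unit)
    (InfTensor.lift fun i => (hs i).antipodeHom.comp (p i))
    (fun i x y => InfTensor.proj_lift _ i (x ⊗ₜ y))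
    (fun i => InfTensor.proj_lift _ i 1)
    (fun i x => InfTensor.proj_lift _ i x)

lemma proj_tensorHopf_mul (hs : ∀ i, HopfStructure k (H i)) (i : ι)
    (x y : InfTensor k fun i => H i) :
    InfTensor.proj k (fun i => H i) i ((tensorHopf H hs).mul (x ⊗ₜ y)) =
      (hs i).mul (InfTensor.proj k (fun i => H i) i x ⊗ₜ InfTensor.proj k (fun i => H i) i y) :=
  InfTensor.proj_lift _ i (x ⊗ₜ y)

lemma proj_tensorHopf_unit (hs : ∀ i, HopfStructure k (H i)) (i : ι) :
    InfTensor.proj k (fun i => H i) i ((tensorHopf H hs).unit 1) = (hs i).unit 1 :=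
  InfTensor.proj_lift _ i 1

lemma proj_tensorHopf_antipode (hs : ∀ i, HopfStructure k (H i)) (i : ι)
    (x : InfTensor k fun i => H i) :
    InfTensor.proj k (fun i => H i) i ((tensorHopf H hs).antipode x) =
      (hs i).antipode (InfTensor.proj k (fun i => H i) i x) :=
  InfTensor.proj_lift _ i x

/-- The Hopf brace structure on a tensor product of cocommutative Hopf braces. -/
def tensorBrace : HopfBrace k (InfTensor k fun i => H i) :=
  HopfBrace.ofJointlyMonic (fun i => (H i).brace) (jointlyMonic_proj H)
    (tensorHopf H fun i => (H i).brace.dot) (tensorHopf H fun i => (H i).brace.circ)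
    (proj_tensorHopf_mul H _) (proj_tensorHopf_antipode H _) (proj_tensorHopf_mul H _)

lemma isTensorBrace_tensorBrace : IsTensorBrace H (tensorBrace H) where
  proj_dot := proj_tensorHopf_mul H _
  proj_dot_one := proj_tensorHopf_unit H _
  proj_dot_antipode := proj_tensorHopf_antipode H _
  proj_circ := proj_tensorHopf_mul H _
  proj_circ_one := proj_tensorHopf_unit H _
  proj_circ_antipode := proj_tensorHopf_antipode H _

-- Multiplication and unit are coalgebra maps, hence determined by their components; the antipode
-- follows from `HopfStructure.ext`.
variable {H} in
lemma hopfStructure_eq_of_proj {s s' : HopfStructure k (InfTensor k fun i => H i)}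
    (hm : ∀ i x y, InfTensor.proj k (fun i => H i) i (s.mul (x ⊗ₜ y)) =
      InfTensor.proj k (fun i => H i) i (s'.mul (x ⊗ₜ y)))
    (hu : ∀ i, InfTensor.proj k (fun i => H i) i (s.unit 1) =
      InfTensor.proj k (fun i => H i) i (s'.unit 1)) : s = s' :=
  HopfStructure.ext
    (InfTensor.hom_ext fun i => CoalgHom.coe_linearMap_injective <|
      TensorProduct.ext' fun x y => hm i x y)
    (InfTensor.hom_ext fun i => CoalgHom.ext_of_ring (hu i))

variable {H} in
lemma IsTensorBrace.unique {B B' : HopfBrace k (InfTensor k fun i => H i)}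
    (hB : IsTensorBrace H B) (hB' : IsTensorBrace H B') : B = B' := by
  have hd : B.dot = B'.dot := hopfStructure_eq_of_proj
    (fun i x y => by rw [hB.proj_dot, hB'.proj_dot])
    (fun i => by rw [hB.proj_dot_one, hB'.proj_dot_one])
  have hc : B.circ = B'.circ := hopfStructure_eq_of_proj
    (fun i x y => by rw [hB.proj_circ, hB'.proj_circ])
    (fun i => by rw [hB.proj_circ_one, hB'.proj_circ_one])
  cases B
  cases B'
  subst hd hc
  rfl

end Tensor

/-! ### Products of cocommutative Hopf braces -/

section Products

variable {ι : Type (max u v)} {H : ι → CocommHopfBraceCat.{u, max u v} k}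
  {B : HopfBrace k (InfTensor k fun i => H i)} (hB : IsTensorBrace H B)

/-- The morphism of Hopf braces to a tensor product with given components. -/
def liftTensor (X : CocommHopfBraceCat.{u, max u v} k) (f : ∀ i, X ⟶ H i) :
    X ⟶ (tensorFan H B hB).pt :=
  let φ : X →ₗc[k] InfTensor k fun i => H i := InfTensor.lift fun i => Hom.toCoalgHom (f i)
  have hφ : ∀ i x, InfTensor.proj k (fun i => H i) i (φ x) = (f i).toCoalgHom x :=
    InfTensor.proj_lift _
  -- Stated for arbitrary Hopf structures so as to serve both multiplications. The two sides are
  -- coalgebra maps on `X ⊗ X` with equal components.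
  have hmul : ∀ (s : HopfStructure k X) (t : HopfStructure k (InfTensor k fun i => H i))
      (r : ∀ i, HopfStructure k (H i))
      (_ : ∀ i x y, (f i).toCoalgHom (s.mul (x ⊗ₜ y)) =
        (r i).mul ((f i).toCoalgHom x ⊗ₜ (f i).toCoalgHom y))
      (_ : ∀ i x y, InfTensor.proj k (fun i => H i) i (t.mul (x ⊗ₜ y)) = (r i).mul
        (InfTensor.proj k (fun i => H i) i x ⊗ₜ InfTensor.proj k (fun i => H i) i y))
      (x y : X), φ (s.mul (x ⊗ₜ y)) = t.mul (φ x ⊗ₜ φ y) := fun s t r hs ht x y => by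
    have h : φ.comp s.mul = t.mul.comp (Coalgebra.TensorProduct.map φ φ) :=
      InfTensor.hom_ext fun i => CoalgHom.coe_linearMap_injective <|
        TensorProduct.ext' fun x y => by
          refine (hφ i _).trans ((hs i x y).trans (Eq.trans ?_ (ht i (φ x) (φ y)).symm))
          rw [hφ, hφ]
    exact CoalgHom.congr_fun h (x ⊗ₜ y)
  have hunit : ∀ (s : HopfStructure k X) (t : HopfStructure k (InfTensor k fun i => H i))
      (r : ∀ i, HopfStructure k (H i)) (_ : ∀ i, (f i).toCoalgHom (s.unit 1) = (r i).unit 1)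
      (_ : ∀ i, InfTensor.proj k (fun i => H i) i (t.unit 1) = (r i).unit 1),
      φ (s.unit 1) = t.unit 1 := fun s t r hs ht => by
    have h : φ.comp s.unit = t.unit :=
      InfTensor.hom_ext fun i => CoalgHom.ext_of_ring <|
        (hφ i _).trans ((hs i).trans (ht i).symm)
    exact CoalgHom.congr_fun h 1
  { toCoalgHom := φ
    map_dot := hmul X.brace.dot B.dot (fun i => (H i).brace.dot) (fun i => (f i).map_dot)
      hB.proj_dot
    map_dot_one := hunit X.brace.dot B.dot (fun i => (H i).brace.dot)
      (fun i => (f i).map_dot_one) hB.proj_dot_one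
    map_circ := hmul X.brace.circ B.circ (fun i => (H i).brace.circ) (fun i => (f i).map_circ)
      hB.proj_circ
    map_circ_one := hunit X.brace.circ B.circ (fun i => (H i).brace.circ)
      (fun i => (f i).map_circ_one) hB.proj_circ_one }

/-- The tensor product of cocommutative Hopf braces is their product. -/
def isLimitTensorFan : Limits.IsLimit (tensorFan H B hB) :=
  Limits.Fan.IsLimit.mk _ (fun s => liftTensor hB s.pt s.proj)
    (fun s i => Hom.ext <| CoalgHom.ext fun x =>
      InfTensor.proj_lift (fun i => Hom.toCoalgHom (s.proj i)) i x)
    (fun s _ hm => Hom.ext <| InfTensor.hom_ext fun i => CoalgHom.ext fun x =>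
      (CoalgHom.congr_fun (congrArg Hom.toCoalgHom (hm i)) x).trans
        (InfTensor.proj_lift (fun i => Hom.toCoalgHom (s.proj i)) i x).symm)

instance : Limits.HasProducts.{max u v} (CocommHopfBraceCat.{u, max u v} k) :=
  Limits.hasProducts_of_limit_fans (fun H => tensorFan H (tensorBrace H)
    (isTensorBrace_tensorBrace H)) fun H => isLimitTensorFan (isTensorBrace_tensorBrace H)

end Products

/-! ### Equalizers of cocommutative Hopf braces -/

section Equalizers

variable {X Y : CocommHopfBraceCat.{u, v} k} (f g : X ⟶ Y)

/-- The equalizer of two morphisms of cocommutative Hopf braces. -/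
def equalizer : CocommHopfBraceCat.{u, v} k where
  carrier := CoalgEqualizer (Hom.toCoalgHom f) (Hom.toCoalgHom g)
  brace := HopfBrace.ofJointlyMonic (fun _ : Unit => X.brace) (CoalgEqualizer.jointlyMonic_ι _ _)
    (CoalgEqualizer.hopfStructure X.brace.dot Y.brace.dot (Hom.map_dot f) (Hom.map_dot g)
      (Hom.map_dot_one f) (Hom.map_dot_one g))
    (CoalgEqualizer.hopfStructure X.brace.circ Y.brace.circ (Hom.map_circ f) (Hom.map_circ g)
      (Hom.map_circ_one f) (Hom.map_circ_one g))
    (fun _ _ _ => rfl) (fun _ _ => rfl) (fun _ _ _ => rfl)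

/-- The inclusion of the equalizer of two morphisms of cocommutative Hopf braces. -/
def equalizerι : equalizer f g ⟶ X :=
  ({ toCoalgHom := CoalgEqualizer.ι (Hom.toCoalgHom f) (Hom.toCoalgHom g)
     map_dot := fun _ _ => rfl
     map_dot_one := rfl
     map_circ := fun _ _ => rfl
     map_circ_one := rfl } : Hom _ X)

lemma equalizer_condition : equalizerι f g ≫ f = equalizerι f g ≫ g :=
  Hom.ext <| CoalgHom.ext fun x => CoalgEqualizer.condition (Hom.toCoalgHom f) (Hom.toCoalgHom g) x

variable {f g} in
/-- A morphism of Hopf braces equalizing `f` and `g` factors through their equalizer. -/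
def liftEqualizer {Z : CocommHopfBraceCat.{u, v} k} (φ : Z ⟶ X) (h : φ ≫ f = φ ≫ g) :
    Z ⟶ equalizer f g :=
  ({ toCoalgHom := CoalgEqualizer.lift (Hom.toCoalgHom φ) fun x =>
      CoalgHom.congr_fun (congrArg Hom.toCoalgHom h) x
     -- The operations of the equalizer are restricted from `X`, so under the injective inclusion
     -- each identity becomes the one for `φ`.
     map_dot := fun x y => CoalgEqualizer.ι_injective _ _ (Hom.map_dot φ x y)
     map_dot_one := CoalgEqualizer.ι_injective _ _ (Hom.map_dot_one φ)
     map_circ := fun x y => CoalgEqualizer.ι_injective _ _ (Hom.map_circ φ x y)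
     map_circ_one := CoalgEqualizer.ι_injective _ _ (Hom.map_circ_one φ) } : Hom Z _)

/-- The universal property of the equalizer of two morphisms of cocommutative Hopf braces. -/
def isLimitEqualizer : Limits.IsLimit (Limits.Fork.ofι _ (equalizer_condition f g)) :=
  Limits.Fork.IsLimit.mk _ (fun s => liftEqualizer s.ι s.condition) (fun _ => rfl)
    fun _ _ hm => Hom.ext <| CoalgHom.ext fun x => CoalgEqualizer.ι_injective _ _ <|
      CoalgHom.congr_fun (congrArg Hom.toCoalgHom hm) x

instance : Limits.HasLimit (Limits.parallelPair f g) :=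
  ⟨⟨⟨_, isLimitEqualizer f g⟩⟩⟩

instance : Limits.HasEqualizers (CocommHopfBraceCat.{u, v} k) :=
  Limits.hasEqualizers_of_hasLimit_parallelPair _

end Equalizers

end CocommHopfBraceCat

end

theorem mainTheorem5 (k : Type u) [Field k] :
    Limits.HasLimits (CocommHopfBraceCat.{u, max u v} k) ∧
    ∀ (ι : Type (max u v)) (H : ι → CocommHopfBraceCat.{u, max u v} k),
      (∀ F : Finset ι, (∀ i, i ∈ F) →
        Function.Bijective (InfTensor.toFin k (fun i => H i) F)) ∧
      (∀ (E : Type w) [AddCommGroup E] [Module k E] [Coalgebra k E] [Coalgebra.IsCocomm k E]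
        (f : ∀ i, E →ₗc[k] H i), ∃! g : E →ₗc[k] InfTensor k (fun i => H i),
          ∀ i, (InfTensor.proj k (fun i => H i) i).comp g = f i) ∧
      ∃ (B : HopfBrace k (InfTensor k fun i => H i))
        (hB : CocommHopfBraceCat.IsTensorBrace H B),
        (∀ B', CocommHopfBraceCat.IsTensorBrace H B' → B' = B) ∧
        Nonempty (Limits.IsLimit (CocommHopfBraceCat.tensorFan H B hB)) := by
  refine ⟨Limits.has_limits_of_hasEqualizers_and_products, fun ι H =>
    ⟨fun F hF => InfTensor.toFin_bijective F hF, ?_, CocommHopfBraceCat.tensorBrace H,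
      CocommHopfBraceCat.isTensorBrace_tensorBrace H, fun B' hB' =>
        hB'.unique (CocommHopfBraceCat.isTensorBrace_tensorBrace H),
      ⟨CocommHopfBraceCat.isLimitTensorFan _⟩⟩⟩
  intro E _ _ _ _ f
  refine ⟨InfTensor.lift f, fun i => CoalgHom.ext fun x => InfTensor.proj_lift f i x,
    fun g hg => InfTensor.hom_ext fun i => ?_⟩
  rw [hg]
  exact CoalgHom.ext fun x => (InfTensor.proj_lift f i x).symm
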